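/- **Theorem (Boundedness for $Y\psi$).** Let $M>0$ and let $g=-D\,dv^2+2\,dv\,dr+r^2\gamma_{\mathbb S^2}$, $D=(1-M/r)^2$, be the extremal Reissner–Nordström metric in ingoing Eddington–Finkelstein coordinates on the domain of outer communications $\{r\ge M\}$ (event horizon $r=M$ included). Put $T=\partial_v$, $Y=\partial_r$ in the coordinates $(v,r)$, let $r^*$ satisfy $dr^*/dr=1/D$, and let $\partial_v=T+\tfrac D2Y$ denote the outgoing derivative in the null coordinates $u=v-2r^*$, $v$. Let $R_0>2M$; for $\tau\ge 0$ let $S_\tau=\{v-r=\tau,\ M\le r\le R_0\}$, let $N_\tau$ be the outgoing null cone $\{u=u_\tau,\ r\ge R_0\}$ that starts at the sphere $\{r=R_0,\ v=\tau+R_0\}$, and let $\Sigma_\tau=S_\tau\cup N_\tau$. Let $A:\mathbb R\to\mathbb R$ be smooth with $|A^{(k)}|\le a_k$ for all $k\ge0$, and let $\psi=\psi(v,r)$ be a spherically symmetric solution, smooth up to and including the horizon and the initial hypersurface, of $$\Box_g\psi=F,\qquad F=A(\psi)\,g^{\mu\nu}\partial_\mu\psi\,\partial_\nu\psi=A(\psi)\bigl(D(Y\psi)^2+2\,T\psi\,Y\psi\bigr),$$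 in the region between $\{v-r=0\}$ and $\Sigma_{\mathcal T}$ (the latter excluded), for some $0<\mathcal T\le\infty$. Its data on $\{v-r=0\}$ are $(\psi,n\psi)=(\varepsilon\psi_0,\varepsilon\psi_1)$, supported in $\{r\le R_0\}$, where $\varepsilon>0$ and $n$ is the future unit normal of the hypersurfaces $\{v-r=\text{const}\}$. Let $$E_0=\int_{S_0}\bigl((Y\psi_0)^2+(T\psi_0)^2\bigr)d\mu_S+\int_{N_0}(\partial_v\psi_0)^2d\mu_N+\int_{\Sigma_0}J^{n_{\Sigma_0}}_\mu[\psi_1]n^\mu_{\Sigma_0}\,d\mu_\Sigma,$$ where the derivatives are those of $\psi_0=\psi/\varepsilon$ and $\psi_1=n\psi/\varepsilon$ regarded as functions on the spacetime; $d\mu_S$ is the induced volume on $S_0$, $d\mu_N=r^2\,dv\,d\omega$ on $N_0$; on $S_0$, $J^n_\mu[f]n^\mu$ is half the sum of the squares of the derivatives of $f$ along $n$ and along the radial unit tangent, and on $N_0$ it is $(\partial_vf)^2$. Let $\alpha>0$ and $C_\alpha>0$, and assume the bootstrap assumptions, for all $0\le\tau_0<\mathcal T$ and all $0\le\tau_1<\tau_2<\mathcal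 T$: $$\int_{S_{\tau_0}}|F|^2\,d\mu_S\le C_\alpha E_0\varepsilon^2(1+\tau_0)^{-2+\alpha},\qquad \int_{\bigcup_{\tau_1\le\tau\le\tau_2}S_\tau}|F|^2\,d\mu_g\le C_\alpha E_0\varepsilon^2(1+\tau_1)^{-2+\alpha},$$ $$\int_{\bigcup_{\tau_1\le\tau\le\tau_2}N_\tau}r^{3-\alpha}|F|^2\,d\mu_g\le C_\alpha E_0\varepsilon^2(1+\tau_1)^{-2+\alpha}.$$ Then there are a constant $C>0$ and constants $C_{\bar\alpha}>0$ ($\bar\alpha>0$) with $C_{\bar\alpha}=O(1/\bar\alpha)$ as $\bar\alpha\to0^+$, which depend only on $M,R_0,(a_k)_k,\alpha,C_\alpha$, and a threshold $\varepsilon_r>0$, which depends only on these quantities and on $E_0$, such that if $0<\varepsilon<\varepsilon_r$, then for all $0\le\tau<\mathcal T$ $$\|Y\psi\|_{L^\infty(\Sigma_\tau)}\le C\sqrt{E_0}\,\varepsilon,$$ and on $\Sigma_\tau$, for every $\bar\alpha>0$, $$|r\psi|\le C_{\bar\alpha}\sqrt{E_0}\,\varepsilon\,r^{\bar\alpha},\qquad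 |r^2\partial_v\psi|\le C_{\bar\alpha}\sqrt{E_0}\,\varepsilon\,r^{\bar\alpha}.$$ -/

import Mathlib

open MeasureTheory Set Filter Topology Asymptotics
open scoped ContDiff ENNReal

noncomputable section

namespace ExtremalRN

/-! Spherically symmetric functions on the domain of outer communications `{r ≥ M}` of the extremal
Reissner-Nordström spacetime of mass `M` are functions `ψ v r` of the ingoing Eddington-Finkelstein
coordinates `(v, r)`, in which the metric is `-D dv² + 2 dv dr + r² γ_{S²}`. -/

/-- The metric coefficient `D = (1 - M/r)²`. -/
def metricD (M r : ℝ) : ℝ := (1 - M / r) ^ 2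

/-- The tortoise coordinate on `r > M`, an antiderivative of `1 / D`. -/
def rstar (M r : ℝ) : ℝ := r + 2 * M * Real.log (r - M) - M ^ 2 / (r - M)

/-- `rstar` is the tortoise coordinate: `dr*/dr = 1/D`. -/
theorem hasDerivAt_rstar (M r : ℝ) (hM : 0 < M) (hr : M < r) :
    HasDerivAt (rstar M) (1 / metricD M r) r := by
  have h0 : r - M ≠ 0 := by linarith [sub_pos.2 hr]
  have h1 : r ≠ 0 := by linarith [hM.trans hr]
  have hid : HasDerivAt (fun x : ℝ => x - M) 1 r := (hasDerivAt_id r).sub_const M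
  have h := ((hasDerivAt_id r).add ((hid.log h0).const_mul (2 * M))).sub
    ((hasDerivAt_const r (M ^ 2)).div hid h0)
  have e : (1 : ℝ) + 2 * M * (1 / (r - M)) - (0 * (r - M) - M ^ 2 * 1) / (r - M) ^ 2
      = 1 / metricD M r := by
    have h2 : (1 - M / r) = (r - M) / r := by field_simp
    unfold metricD
    rw [h2]
    field_simp
    ring
  rw [← e]
  exact h

/-- The vector field `T = ∂_v` in the coordinates `(v, r)`. -/
def vfT (ψ : ℝ → ℝ → ℝ) (v r : ℝ) : ℝ := deriv (fun v' => ψ v' r) v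

/-- The vector field `Y = ∂_r` in the coordinates `(v, r)`. -/
def vfY (ψ : ℝ → ℝ → ℝ) (v r : ℝ) : ℝ := deriv (fun r' => ψ v r') r

/-- The outgoing null derivative: `∂_v` at fixed `u` in the null coordinates
`u = t - r* = v - 2 r*`, `v = t + r*`. Since `∂r/∂v = D/2` at fixed `u`, it is `T + (D/2) Y`. -/
def nullDv (M : ℝ) (ψ : ℝ → ℝ → ℝ) (v r : ℝ) : ℝ :=
  vfT ψ v r + metricD M r / 2 * vfY ψ v r

/-- The d'Alembertian `□_g` on spherically symmetric functions. -/
def box (M : ℝ) (ψ : ℝ → ℝ → ℝ) (v r : ℝ) : ℝ :=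
  metricD M r * vfY (vfY ψ) v r + 2 * vfT (vfY ψ) v r + 2 / r * vfT ψ v r
    + (deriv (metricD M) r + 2 * metricD M r / r) * vfY ψ v r

/-- The nonlinearity `F = A(ψ) g^{αβ} ∂_α ψ ∂_β ψ` on spherically symmetric functions. -/
def nonlin (M : ℝ) (A : ℝ → ℝ) (ψ : ℝ → ℝ → ℝ) (v r : ℝ) : ℝ :=
  A (ψ v r) * (metricD M r * vfY ψ v r ^ 2 + 2 * vfT ψ v r * vfY ψ v r)

/-- `A` is smooth and `|A^{(k)}| ≤ a_k` for every `k`. -/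
structure BoundedGeometry (a : ℕ → ℝ) (A : ℝ → ℝ) : Prop where
  smooth : ContDiff ℝ ∞ A
  bound : ∀ k x, |iteratedDeriv k A x| ≤ a k

/-! ### Foliations -/

/-- The spacelike part `S_τ = {t* = τ} ∩ {M ≤ r ≤ R₀}`, with `t* = v - r`; points are `(v, r)`. -/
def leafS (M R₀ τ : ℝ) : Set (ℝ × ℝ) :=
  {p | p.1 - p.2 = τ ∧ M ≤ p.2 ∧ p.2 ≤ R₀}

/-- The value of `v` at the point of radius `r` of the outgoing null cone `N_τ`, on which
`u = v - 2 r*` is constant and which starts at the sphere `r = R₀`, `v = τ + R₀`. -/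
def nullV (M R₀ τ r : ℝ) : ℝ := τ + R₀ + 2 * (rstar M r - rstar M R₀)

/-- The null part `N_τ = {u = u_τ, v ≥ v_τ}`. -/
def leafN (M R₀ τ : ℝ) : Set (ℝ × ℝ) :=
  {p | R₀ ≤ p.2 ∧ p.1 = nullV M R₀ τ p.2}

/-- The leaf `Σ_τ = S_τ ∪ N_τ` of the spacelike-null foliation. -/
def leafSigma (M R₀ τ : ℝ) : Set (ℝ × ℝ) := leafS M R₀ τ ∪ leafN M R₀ τ

/-- The part of the domain of outer communications (event horizon `r = M` included) to the future
of the initial hypersurface `{t* = 0}` and strictly before `Σ_𝒯`, where `𝒯 ≤ ∞`. -/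
def region (M R₀ : ℝ) (𝒯 : EReal) : Set (ℝ × ℝ) :=
  {p | M ≤ p.2 ∧ 0 ≤ p.1 - p.2 ∧ ∃ τ : ℝ, (τ : EReal) < 𝒯 ∧ p ∈ leafSigma M R₀ τ}

/-- The future unit normal `n = (T - (1 - D) Y) / √(2 - D)` of the hypersurfaces `{t* = τ}`. -/
def normalDeriv (M : ℝ) (ψ : ℝ → ℝ → ℝ) (v r : ℝ) : ℝ :=
  (vfT ψ v r - (1 - metricD M r) * vfY ψ v r) / √(2 - metricD M r)

/-- The radial unit tangent `(T + Y) / √(2 - D)` of the hypersurfaces `{t* = τ}`. -/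
def tangentDeriv (M : ℝ) (ψ : ℝ → ℝ → ℝ) (v r : ℝ) : ℝ :=
  (vfT ψ v r + vfY ψ v r) / √(2 - metricD M r)

/-- `J^n_μ[ψ] n^μ`, the energy-momentum tensor of `ψ` evaluated on `(n, n)`. -/
def energyDensity (M : ℝ) (ψ : ℝ → ℝ → ℝ) (v r : ℝ) : ℝ :=
  (normalDeriv M ψ v r ^ 2 + tangentDeriv M ψ v r ^ 2) / 2

/-! ### Integrals of nonnegative spherically symmetric functions -/

/-- `∫_{S_τ} f dμ_S`; the induced metric on `S_τ` is `(2 - D) dr² + r² γ_{S²}`. -/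
def intS (M R₀ τ : ℝ) (f : ℝ → ℝ → ℝ) : ℝ≥0∞ :=
  ∫⁻ r in Icc M R₀, ENNReal.ofReal (4 * Real.pi * r ^ 2 * √(2 - metricD M r) * f (τ + r) r)

/-- `∫_{N_τ} f dμ_N` with `dμ_N = r² dv dω`, written in `r` through `dv = (2/D) dr`. -/
def intN (M R₀ τ : ℝ) (f : ℝ → ℝ → ℝ) : ℝ≥0∞ :=
  ∫⁻ r in Ici R₀, ENNReal.ofReal (4 * Real.pi * r ^ 2 * (2 / metricD M r) * f (nullV M R₀ τ r) r)

/-- The spacetime integral of `f` over `⋃_{τ₁ ≤ τ ≤ τ₂} S_τ`; the volume form is `r² dτ dr dω`. -/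
def bulkS (M R₀ τ₁ τ₂ : ℝ) (f : ℝ → ℝ → ℝ) : ℝ≥0∞ :=
  ∫⁻ τ in Icc τ₁ τ₂, ∫⁻ r in Icc M R₀, ENNReal.ofReal (4 * Real.pi * r ^ 2 * f (τ + r) r)

/-- The spacetime integral of `f` over `⋃_{τ₁ ≤ τ ≤ τ₂} N_τ`; the volume form is
`(D/2) r² du dv dω = r² dτ dr dω`. -/
def bulkN (M R₀ τ₁ τ₂ : ℝ) (f : ℝ → ℝ → ℝ) : ℝ≥0∞ :=
  ∫⁻ τ in Icc τ₁ τ₂, ∫⁻ r in Ici R₀,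
    ENNReal.ofReal (4 * Real.pi * r ^ 2 * f (nullV M R₀ τ r) r)

/-- The initial energy of the data `(ψ, nψ)` on `Σ_0 = S_0 ∪ N_0`:
`∫_{S_0} (Yψ)² + (Tψ)² + ∫_{N_0} (∂_v ψ)² + ∫_{Σ_0} J^n[nψ] n`, the last density being
`(∂_v nψ)²` on the null part. -/
def initialEnergy (M R₀ : ℝ) (ψ : ℝ → ℝ → ℝ) : ℝ≥0∞ :=
  intS M R₀ 0 (fun v r => vfY ψ v r ^ 2 + vfT ψ v r ^ 2)
    + intN M R₀ 0 (fun v r => nullDv M ψ v r ^ 2)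
    + (intS M R₀ 0 (energyDensity M (normalDeriv M ψ))
      + intN M R₀ 0 (fun v r => nullDv M (normalDeriv M ψ) v r ^ 2))

/-! ### Solutions and bootstrap assumptions -/

/-- `ψ` is a spherically symmetric solution of `□_g ψ = F` on `region M R₀ 𝒯`, smooth up to and
including the horizon and the initial hypersurface `{t* = 0}`, whose data `(ψ, nψ)` on that
hypersurface are supported in `{r ≤ R₀}`. -/
structure IsSolution (M R₀ : ℝ) (A : ℝ → ℝ) (𝒯 : EReal) (ψ : ℝ → ℝ → ℝ) : Prop where
  smooth : ∀ p ∈ region M R₀ 𝒯, ContDiffAt ℝ ∞ (fun q : ℝ × ℝ => ψ q.1 q.2) p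
  equation : ∀ p ∈ region M R₀ 𝒯, box M ψ p.1 p.2 = nonlin M A ψ p.1 p.2
  support : ∀ r, R₀ < r → ψ r r = 0 ∧ normalDeriv M ψ r r = 0

/-- The bootstrap assumptions (A1), (A2), (A3) for `0 ≤ τ < 𝒯`. -/
structure Bootstrap (M R₀ : ℝ) (A : ℝ → ℝ) (α Cα E₀ ε : ℝ) (𝒯 : EReal) (ψ : ℝ → ℝ → ℝ) :
    Prop where
  A1 : ∀ τ₀ : ℝ, 0 ≤ τ₀ → (τ₀ : EReal) < 𝒯 →
    intS M R₀ τ₀ (fun v r => nonlin M A ψ v r ^ 2)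
      ≤ ENNReal.ofReal (Cα * E₀ * ε ^ 2 * (1 + τ₀) ^ (-2 + α))
  A2 : ∀ τ₁ τ₂ : ℝ, 0 ≤ τ₁ → τ₁ < τ₂ → (τ₂ : EReal) < 𝒯 →
    bulkS M R₀ τ₁ τ₂ (fun v r => nonlin M A ψ v r ^ 2)
      ≤ ENNReal.ofReal (Cα * E₀ * ε ^ 2 * (1 + τ₁) ^ (-2 + α))
  A3 : ∀ τ₁ τ₂ : ℝ, 0 ≤ τ₁ → τ₁ < τ₂ → (τ₂ : EReal) < 𝒯 →
    bulkN M R₀ τ₁ τ₂ (fun v r => r ^ (3 - α) * nonlin M A ψ v r ^ 2)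
      ≤ ENNReal.ofReal (Cα * E₀ * ε ^ 2 * (1 + τ₁) ^ (-2 + α))

end ExtremalRN

end

open ExtremalRN

open ExtremalRN

/-! The right-hand side is a null form in which only `A(ψ)` multiplies the metric contraction, so it
can be gauged away. If `G' = exp (-∫ A)`, then `G'' = -A G'` and `φ = G(ψ)` satisfies `□φ = 0`
exactly. For small data `G` is bi-Lipschitz at the size of `ψ`, with constants `exp (±b)`, `b` a
bound of `|A|`. Everything thus reduces to pointwise bounds for the linear equation in terms of
pointwise bounds on the data, which follow from the initial energy in one dimension
(`exists_data_bound`).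

The linear estimate (`abs_mul_le_of_box_eq_zero`) applies the `T`-energy to a time integral `Φ`, `TΦ
= φ`, since this energy then controls `rφ` itself. `Φ` never appears: the equation makes `r² (D Yφ +
Tφ) dv - r² Yφ dr` closed, and its primitive `η` plays the role of `r² (D YΦ + TΦ)`. The quantities
`P = rφ + η/r` and `Q = rφ - η/r` are then `2r ∂_vΦ` and `2r ∂_uΦ`. The energy flux is again a
closed form, `(P² - Q²) dv + 2 Q²/D dr`; it gives `2 P²/D dr` on outgoing rays and `2 Q²/D dr` on
ingoing ones. Its initial value stays finite near the horizon because the constant in `η` makes `Q`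
vanish there to first order in `r - M`. Finally `P` changes by `∫ Q/r dr` along ingoing rays and `Q`
by `∫ P/r dr` along outgoing rays, so the fluxes bound both, and `rφ = (P + Q)/2`.

Derivatives follow by transport. Along outgoing rays `d/dr (D Y(rφ)) = D' φ`; as `D' ≥ 0`,
integration returns a multiple of `D`, and the degenerate factor cancels without any red-shift
(`abs_vfY_mul_le_of_box_eq_zero`). Along ingoing rays `∂_v(rφ)` has `r`-derivative `D' φ / 2 =
O(r⁻³)`, which gives the decay `r⁻²` (`abs_nullDv_mul_le_of_box_eq_zero`).

All this takes place in the past triangle of a point with `r > M`, with constants independent of the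
point; the horizon is reached by continuity. -/

namespace ExtremalRN

/-! ### Gradients of functions of two variables -/

/-- `f` has partial derivatives `a`, `b` within `K` at `p`, as a Fréchet derivative. -/
def HasGrad (f : ℝ × ℝ → ℝ) (a b : ℝ) (K : Set (ℝ × ℝ)) (p : ℝ × ℝ) : Prop :=
  HasFDerivWithinAt f
    (a • ContinuousLinearMap.fst ℝ ℝ ℝ + b • ContinuousLinearMap.snd ℝ ℝ ℝ) K p

namespace HasGrad

variable {f g : ℝ × ℝ → ℝ} {a b a' b' : ℝ} {K : Set (ℝ × ℝ)} {p : ℝ × ℝ}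

theorem congr_grad (h : HasGrad f a b K p) (ha : a = a') (hb : b = b') : HasGrad f a' b' K p :=
  ha ▸ hb ▸ h

theorem mono (h : HasGrad f a b univ p) : HasGrad f a b K p :=
  HasFDerivWithinAt.mono h (subset_univ K)

theorem add (hf : HasGrad f a b K p) (hg : HasGrad g a' b' K p) :
    HasGrad (fun q => f q + g q) (a + a') (b + b') K p := by
  unfold HasGrad at *
  convert! HasFDerivWithinAt.add hf hg using 1
  ext <;> simp

theorem sub (hf : HasGrad f a b K p) (hg : HasGrad g a' b' K p) :
    HasGrad (fun q => f q - g q) (a - a') (b - b') K p := by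
  unfold HasGrad at *
  convert! HasFDerivWithinAt.sub hf hg using 1
  ext <;> simp

theorem mul (hf : HasGrad f a b K p) (hg : HasGrad g a' b' K p) :
    HasGrad (fun q => f q * g q) (a * g p + f p * a') (b * g p + f p * b') K p := by
  unfold HasGrad at *
  convert! HasFDerivWithinAt.mul hf hg using 1
  ext <;> simp <;> ring

theorem radial {h : ℝ → ℝ} {h' : ℝ} (hh : HasDerivAt h h' p.2) :
    HasGrad (fun q => h q.2) 0 h' K p := by
  unfold HasGrad
  convert! (hh.comp_hasFDerivWithinAt p (hasFDerivWithinAt_snd (𝕜 := ℝ) (s := K) (p := p))) using 1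
  ext <;> simp

theorem comp {h : ℝ → ℝ} {h' : ℝ} (hh : HasDerivAt h h' (f p)) (hf : HasGrad f a b K p) :
    HasGrad (fun q => h (f q)) (h' * a) (h' * b) K p := by
  unfold HasGrad at *
  convert! (hh.comp_hasFDerivWithinAt p hf) using 1
  ext <;> simp

theorem along (hf : HasGrad f a b K p) {x y : ℝ → ℝ} {x' y' t : ℝ} {s : Set ℝ}
    (hx : HasDerivWithinAt x x' s t) (hy : HasDerivWithinAt y y' s t) (hp : (x t, y t) = p)
    (hK : ∀ t ∈ s, (x t, y t) ∈ K) :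
    HasDerivWithinAt (fun t => f (x t, y t)) (a * x' + b * y') s t := by
  subst hp
  have := HasFDerivWithinAt.comp_hasDerivWithinAt (f := fun t => (x t, y t)) t hf
    (hx.prodMk hy) hK
  simpa using! this

end HasGrad

/-- A closed `1`-form `a dv + b dr` on a convex set has a primitive. -/
theorem exists_hasGrad_of_closed {K : Set (ℝ × ℝ)} (hK : Convex ℝ K) {a b : ℝ × ℝ → ℝ}
    {av ar bv br : ℝ × ℝ → ℝ} (ha : ∀ p ∈ K, HasGrad a (av p) (ar p) K p)
    (hb : ∀ p ∈ K, HasGrad b (bv p) (br p) K p) (hab : ∀ p ∈ K, ar p = bv p) :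
    ∃ f, ∀ p ∈ K, HasGrad f (a p) (b p) K p := by
  refine hK.exists_forall_hasFDerivWithinAt_of_hasFDerivWithinAt_symmetric (F := ℝ) (𝕜 := ℝ)
    (dω := fun p =>
      (av p • ContinuousLinearMap.fst ℝ ℝ ℝ + ar p • ContinuousLinearMap.snd ℝ ℝ ℝ).smulRight
        (ContinuousLinearMap.fst ℝ ℝ ℝ) +
      (bv p • ContinuousLinearMap.fst ℝ ℝ ℝ + br p • ContinuousLinearMap.snd ℝ ℝ ℝ).smulRight
        (ContinuousLinearMap.snd ℝ ℝ ℝ)) ?_ ?_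
  · intro p hp
    have h1 := HasFDerivWithinAt.smul_const (ha p hp) (ContinuousLinearMap.fst ℝ ℝ ℝ)
    have h2 := HasFDerivWithinAt.smul_const (hb p hp) (ContinuousLinearMap.snd ℝ ℝ ℝ)
    exact h1.add h2
  · intro p hp x _ y _
    simp [hab p hp]
    ring

/-! ### Monotonicity -/

theorem le_of_hasDerivWithinAt_nonneg {f f' : ℝ → ℝ} {x y : ℝ} (hxy : x ≤ y)
    (hf : ∀ t ∈ Icc x y, HasDerivWithinAt f (f' t) (Icc x y) t)
    (h0 : ∀ t ∈ Icc x y, 0 ≤ f' t) : f x ≤ f y := by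
  refine monotoneOn_of_hasDerivWithinAt_nonneg (convex_Icc x y)
    (fun t ht => (hf t ht).continuousWithinAt) (f' := f') (fun t ht => ?_) (fun t ht => ?_)
    (left_mem_Icc.2 hxy) (right_mem_Icc.2 hxy) hxy
  · exact (hf t (interior_subset ht)).mono interior_subset
  · exact h0 t (interior_subset ht)

/-- Both `g - f` and `g + f` are monotone. An explicit majorant `g` replaces the integral of `|f'|`
in every transport estimate, so no integrability has to be checked. -/
theorem abs_sub_le_sub_of_abs_deriv_le {f f' g g' : ℝ → ℝ} {x y : ℝ} (hxy : x ≤ y)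
    (hf : ∀ t ∈ Icc x y, HasDerivWithinAt f (f' t) (Icc x y) t)
    (hg : ∀ t ∈ Icc x y, HasDerivWithinAt g (g' t) (Icc x y) t)
    (h0 : ∀ t ∈ Icc x y, |f' t| ≤ g' t) : |f y - f x| ≤ g y - g x := by
  have h1 := le_of_hasDerivWithinAt_nonneg hxy (fun t ht => (hg t ht).sub (hf t ht))
    (fun t ht => by linarith [(abs_le.1 (h0 t ht)).2])
  have h2 := le_of_hasDerivWithinAt_nonneg hxy (fun t ht => (hg t ht).add (hf t ht))
    (fun t ht => by linarith [(abs_le.1 (h0 t ht)).1])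
  simp only [Pi.sub_apply, Pi.add_apply] at h1 h2
  rw [abs_le]
  constructor <;> linarith

theorem eq_of_hasDerivWithinAt_zero {f : ℝ → ℝ} {x y : ℝ} (hxy : x ≤ y)
    (hf : ∀ t ∈ Icc x y, HasDerivWithinAt f 0 (Icc x y) t) : f x = f y := by
  have := abs_sub_le_sub_of_abs_deriv_le hxy hf (fun t _ => hasDerivWithinAt_const t (Icc x y) (0:ℝ))
    (by simp)
  simp only [sub_self, abs_nonpos_iff] at this
  linarith

/-! ### The coordinate vector fields on smooth functions -/

/-- Smoothness of `ψ v r` near the point `p = (v, r)`. -/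
abbrev SmoothAt (ψ : ℝ → ℝ → ℝ) (p : ℝ × ℝ) : Prop :=
  ContDiffAt ℝ ∞ (fun q : ℝ × ℝ => ψ q.1 q.2) p

namespace SmoothAt

variable {ψ : ℝ → ℝ → ℝ} {p : ℝ × ℝ}

theorem vfT_eq (h : DifferentiableAt ℝ (fun q : ℝ × ℝ => ψ q.1 q.2) p) :
    vfT ψ p.1 p.2 = fderiv ℝ (fun q : ℝ × ℝ => ψ q.1 q.2) p (1, 0) := by
  have := h.hasFDerivAt.comp_hasDerivAt p.1
    ((hasDerivAt_id p.1).prodMk (hasDerivAt_const p.1 p.2))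
  exact this.deriv

theorem vfY_eq (h : DifferentiableAt ℝ (fun q : ℝ × ℝ => ψ q.1 q.2) p) :
    vfY ψ p.1 p.2 = fderiv ℝ (fun q : ℝ × ℝ => ψ q.1 q.2) p (0, 1) := by
  have := h.hasFDerivAt.comp_hasDerivAt p.2
    ((hasDerivAt_const p.2 p.1).prodMk (hasDerivAt_id p.2))
  exact this.deriv

theorem differentiableAt (h : SmoothAt ψ p) :
    DifferentiableAt ℝ (fun q : ℝ × ℝ => ψ q.1 q.2) p :=
  ContDiffAt.differentiableAt h (by simp)

theorem eventually_differentiableAt (h : SmoothAt ψ p) :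
    ∀ᶠ q in 𝓝 p, DifferentiableAt ℝ (fun q : ℝ × ℝ => ψ q.1 q.2) q := by
  have h1 : ContDiffAt ℝ 1 (fun q : ℝ × ℝ => ψ q.1 q.2) p := h.of_le (by simp)
  filter_upwards [h1.eventually (by simp)] with q hq
  exact hq.differentiableAt (by simp)

theorem hasGrad (h : SmoothAt ψ p) {K : Set (ℝ × ℝ)} :
    HasGrad (fun q => ψ q.1 q.2) (vfT ψ p.1 p.2) (vfY ψ p.1 p.2) K p := by
  refine HasGrad.mono ?_
  unfold HasGrad
  rw [hasFDerivWithinAt_univ, vfT_eq h.differentiableAt, vfY_eq h.differentiableAt]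
  convert! h.differentiableAt.hasFDerivAt using 1
  ext <;> simp

theorem vfT_eventuallyEq (h : SmoothAt ψ p) :
    (fun q : ℝ × ℝ => vfT ψ q.1 q.2) =ᶠ[𝓝 p]
      fun q => fderiv ℝ (fun q : ℝ × ℝ => ψ q.1 q.2) q (1, 0) := by
  filter_upwards [h.eventually_differentiableAt] with q hq using vfT_eq hq

theorem vfY_eventuallyEq (h : SmoothAt ψ p) :
    (fun q : ℝ × ℝ => vfY ψ q.1 q.2) =ᶠ[𝓝 p]
      fun q => fderiv ℝ (fun q : ℝ × ℝ => ψ q.1 q.2) q (0, 1) := by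
  filter_upwards [h.eventually_differentiableAt] with q hq using vfY_eq hq

theorem vfT (h : SmoothAt ψ p) : SmoothAt (vfT ψ) p :=
  ((h.fderiv_right (m := ∞) (by simp)).clm_apply contDiffAt_const).congr_of_eventuallyEq
    h.vfT_eventuallyEq

theorem vfY (h : SmoothAt ψ p) : SmoothAt (vfY ψ) p :=
  ((h.fderiv_right (m := ∞) (by simp)).clm_apply contDiffAt_const).congr_of_eventuallyEq
    h.vfY_eventuallyEq

theorem vfT_vfY (h : SmoothAt ψ p) :
    ExtremalRN.vfT (ExtremalRN.vfY ψ) p.1 p.2 = ExtremalRN.vfY (ExtremalRN.vfT ψ) p.1 p.2 := by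
  have hd : DifferentiableAt ℝ (fderiv ℝ (fun q : ℝ × ℝ => ψ q.1 q.2)) p :=
    (h.fderiv_right (m := ∞) (by simp)).differentiableAt (by simp)
  rw [vfT_eq h.vfY.differentiableAt, vfY_eq h.vfT.differentiableAt,
    h.vfT_eventuallyEq.fderiv_eq, h.vfY_eventuallyEq.fderiv_eq,
    fderiv_clm_apply hd (by fun_prop), fderiv_clm_apply hd (by fun_prop)]
  have := (ContDiffAt.isSymmSndFDerivAt h
    (by
      rw [minSmoothness_of_isRCLikeNormedField]
      exact WithTop.coe_le_coe.2 le_top)).eq (1, 0) (0, 1)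
  simpa using! this

end SmoothAt

/-! ### The metric coefficient and the tortoise coordinate -/

theorem hasDerivAt_metricD {M r : ℝ} (hr : r ≠ 0) :
    HasDerivAt (metricD M) (2 * (1 - M / r) * (M / r ^ 2)) r := by
  have h := (((hasDerivAt_const r M).div (hasDerivAt_id r) hr).const_sub 1).pow 2
  refine (h.congr_deriv ?_)
  simp
  ring

theorem deriv_metricD {M r : ℝ} (hr : r ≠ 0) :
    deriv (metricD M) r = 2 * (1 - M / r) * (M / r ^ 2) := (hasDerivAt_metricD hr).deriv

theorem contDiffAt_metricD {M r : ℝ} (hr : r ≠ 0) : ContDiffAt ℝ ∞ (metricD M) r := by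
  unfold metricD
  exact (contDiffAt_const.sub (contDiffAt_const.div contDiffAt_id hr)).pow 2

theorem metricD_eq {M r : ℝ} (hr : r ≠ 0) : metricD M r = ((r - M) / r) ^ 2 := by
  unfold metricD
  congr 1
  field_simp

theorem metricD_pos {M r : ℝ} (hM : 0 < M) (hr : M < r) : 0 < metricD M r := by
  rw [metricD_eq (hM.trans hr).ne']
  have := sub_pos.2 hr
  have := hM.trans hr
  positivity

theorem metricD_nonneg (M r : ℝ) : 0 ≤ metricD M r := sq_nonneg _

theorem metricD_le_one {M r : ℝ} (hM : 0 < M) (hr : M ≤ r) : metricD M r ≤ 1 := by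
  have h0 : 0 < r := hM.trans_le hr
  have h1 : 0 ≤ M / r := by positivity
  have h2 : M / r ≤ 1 := (div_le_one h0).2 hr
  unfold metricD
  nlinarith

theorem deriv_metricD_nonneg {M r : ℝ} (hM : 0 < M) (hr : M ≤ r) : 0 ≤ deriv (metricD M) r := by
  have h0 : 0 < r := hM.trans_le hr
  have h2 : M / r ≤ 1 := (div_le_one h0).2 hr
  rw [deriv_metricD h0.ne']
  have : 0 ≤ 1 - M / r := by linarith
  positivity

theorem deriv_metricD_le {M r : ℝ} (hM : 0 < M) (hr : M ≤ r) :
    deriv (metricD M) r ≤ 2 * M / r ^ 2 := by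
  have h0 : 0 < r := hM.trans_le hr
  have h1 : 0 ≤ M / r := by positivity
  have h2 : 0 ≤ M / r ^ 2 := by positivity
  rw [deriv_metricD h0.ne', mul_div_assoc]
  nlinarith

/-- On an outgoing ray `v - r = const + 2 r* - r`, with slope `2/D - 1 ≥ 1` because `D ≤ 1`: the
function `v - r` is a time function along these rays. -/
theorem strictMonoOn_rstar_sub {M : ℝ} (hM : 0 < M) :
    StrictMonoOn (fun r => 2 * rstar M r - r) (Ioi M) := by
  refine strictMonoOn_of_hasDerivWithinAt_pos (convex_Ioi M)
    (f' := fun r => 2 * (1 / metricD M r) - 1) ?_ ?_ ?_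
  · intro r hr
    exact (((hasDerivAt_rstar M r hM hr).const_mul 2).sub
      (hasDerivAt_id r)).continuousAt.continuousWithinAt
  · intro r hr
    rw [interior_Ioi] at hr
    exact (((hasDerivAt_rstar M r hM hr).const_mul 2).sub (hasDerivAt_id r)).hasDerivWithinAt
  · intro r hr
    rw [interior_Ioi] at hr
    have := one_le_one_div (metricD_pos hM hr) (metricD_le_one hM hr.le)
    linarith

/-- `1/D` decreases in `r`. Hence `u = v - 2 r*` is a convex function of `(v, r)` and past triangles
are convex, which is what the primitives of closed forms require. -/
theorem concaveOn_rstar {M : ℝ} (hM : 0 < M) : ConcaveOn ℝ (Ioi M) (rstar M) := by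
  refine AntitoneOn.concaveOn_of_deriv (convex_Ioi M)
    (fun r hr => (hasDerivAt_rstar M r hM hr).continuousAt.continuousWithinAt) ?_ ?_
  · rw [interior_Ioi]
    exact fun r hr => (hasDerivAt_rstar M r hM hr).differentiableAt.differentiableWithinAt
  · rw [interior_Ioi]
    intro r hr s hs hrs
    rw [(hasDerivAt_rstar M r hM hr).deriv, (hasDerivAt_rstar M s hM hs).deriv]
    refine one_div_le_one_div_of_le (metricD_pos hM hr) ?_
    have h0 : 0 < r := hM.trans hr
    have h1 : M / s ≤ M / r := div_le_div_of_nonneg_left hM.le h0 hrs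
    have h2 : M / r ≤ 1 := (div_le_one h0).2 (le_of_lt hr)
    unfold metricD
    gcongr

/-! ### Causal pasts -/

/-- The causal past, in `{r > M, v ≥ r}`, of the point `p = (v, r)`. -/
def pastTriangle (M : ℝ) (p : ℝ × ℝ) : Set (ℝ × ℝ) :=
  {q | M < q.2 ∧ q.2 ≤ q.1 ∧ q.1 ≤ p.1 ∧ q.1 - 2 * rstar M q.2 ≤ p.1 - 2 * rstar M p.2}

theorem self_mem_pastTriangle {M : ℝ} {p : ℝ × ℝ} (h1 : M < p.2) (h2 : p.2 ≤ p.1) :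
    p ∈ pastTriangle M p := ⟨h1, h2, le_rfl, le_rfl⟩

theorem pastTriangle_subset {M : ℝ} {p q : ℝ × ℝ} (h : q ∈ pastTriangle M p) :
    pastTriangle M q ⊆ pastTriangle M p :=
  fun _ hx => ⟨hx.1, hx.2.1, hx.2.2.1.trans h.2.2.1, hx.2.2.2.trans h.2.2.2⟩

theorem convex_pastTriangle {M : ℝ} (hM : 0 < M) (p : ℝ × ℝ) : Convex ℝ (pastTriangle M p) := by
  intro x hx y hy s t hs ht hst
  obtain ⟨x1, x2, x3, x4⟩ := hx
  obtain ⟨y1, y2, y3, y4⟩ := hy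
  have hc := (concaveOn_rstar hM).2 x1 y1 hs ht hst
  have hm := (convex_Ioi M) x1 y1 hs ht hst
  simp only [smul_eq_mul, mem_Ioi] at hc hm
  refine ⟨by simpa using hm, ?_, ?_, ?_⟩ <;>
    simp only [Prod.fst_add, Prod.snd_add, Prod.smul_fst, Prod.smul_snd, smul_eq_mul]
  · nlinarith [mul_le_mul_of_nonneg_left x2 hs, mul_le_mul_of_nonneg_left y2 ht]
  · calc s * x.1 + t * y.1 ≤ s * p.1 + t * p.1 := by gcongr
      _ = p.1 := by rw [← add_mul, hst, one_mul]
  · have e : p.1 - 2 * rstar M p.2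
        = s * (p.1 - 2 * rstar M p.2) + t * (p.1 - 2 * rstar M p.2) := by
      rw [← add_mul, hst, one_mul]
    rw [e]
    nlinarith [mul_le_mul_of_nonneg_left x4 hs, mul_le_mul_of_nonneg_left y4 ht]

/-- The past outgoing null ray from `p` meets the initial hypersurface `{v = r}`. -/
theorem exists_initial_point {M : ℝ} (hM : 0 < M) {p : ℝ × ℝ} (h1 : M < p.2) (h2 : p.2 ≤ p.1) :
    ∃ ρ, M < ρ ∧ ρ ≤ p.2 ∧ p.1 - 2 * rstar M p.2 + 2 * rstar M ρ = ρ := by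
  set u := p.1 - 2 * rstar M p.2 with hu
  obtain ⟨s, hs1, hs2, hs3⟩ : ∃ s, M < s ∧ s ≤ p.2 ∧ u + 2 * rstar M s ≤ s := by
    -- Near the horizon the term `-M²/(r - M)` drives `r*` to `-∞`. At `r = M + d` with `d ≤ 1` the
    -- other terms of `u + 2 r* - r` add up to at most `c`, and `d ≤ 2M²/c` beats them.
    set c := |u| + M + 1 with hc
    have hc0 : 0 < c := by positivity
    obtain ⟨d, hd0, hd1, hd2, hd3⟩ : ∃ d, 0 < d ∧ d ≤ 1 ∧ d ≤ p.2 - M ∧ d ≤ 2 * M ^ 2 / c := by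
      refine ⟨min 1 (min (p.2 - M) (2 * M ^ 2 / c)), ?_, min_le_left _ _,
        (min_le_right _ _).trans (min_le_left _ _), (min_le_right _ _).trans (min_le_right _ _)⟩
      have := sub_pos.2 h1
      positivity
    refine ⟨M + d, by linarith, by linarith, ?_⟩
    have hlog : Real.log d ≤ 0 := Real.log_nonpos hd0.le hd1
    have hdiv : c ≤ 2 * M ^ 2 / d := by
      rw [le_div_iff₀ hd0]
      rw [le_div_iff₀ hc0] at hd3
      linarith
    have e : rstar M (M + d) = M + d + 2 * M * Real.log d - M ^ 2 / d := by
      simp [rstar]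
    rw [mul_div_assoc] at hdiv
    nlinarith [le_abs_self u, mul_nonneg hM.le (neg_nonneg.2 hlog)]
  have hcont : ContinuousOn (fun x => u + 2 * rstar M x - x) (Icc s p.2) := fun x hx =>
    (((hasDerivAt_rstar M x hM (hs1.trans_le hx.1)).const_mul 2).const_add u |>.sub
      (hasDerivAt_id x)).continuousAt.continuousWithinAt
  obtain ⟨ρ, hρ, hρ0⟩ := intermediate_value_Icc hs2 hcont
    (show (0 : ℝ) ∈ Icc _ _ from ⟨sub_nonpos.2 hs3, sub_nonneg.2 (by linarith)⟩)
  exact ⟨ρ, hs1.trans_le hρ.1, hρ.2, by simp only at hρ0; linarith⟩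

/-! ### The three sides of a past triangle -/

theorem rstar_sub_le {M s t : ℝ} (hM : 0 < M) (hs : M < s) (hst : s ≤ t) :
    2 * rstar M s - s ≤ 2 * rstar M t - t :=
  (strictMonoOn_rstar_sub hM).monotoneOn hs (hs.trans_le hst) hst

theorem ingoing_mem {M : ℝ} (hM : 0 < M) {p : ℝ × ℝ} (h1 : M < p.2) {t : ℝ}
    (ht : t ∈ Icc p.2 p.1) : (p.1, t) ∈ pastTriangle M p :=
  ⟨h1.trans_le ht.1, ht.2, le_rfl, by
    have := rstar_sub_le hM h1 ht.1
    simp only; linarith [ht.1]⟩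

theorem outgoing_mem {M : ℝ} (hM : 0 < M) {p : ℝ × ℝ} {ρ : ℝ} (hρ : M < ρ)
    (h : p.1 - 2 * rstar M p.2 + 2 * rstar M ρ = ρ) {t : ℝ} (ht : t ∈ Icc ρ p.2) :
    (p.1 - 2 * rstar M p.2 + 2 * rstar M t, t) ∈ pastTriangle M p := by
  have h3 := rstar_sub_le hM hρ ht.1
  have h4 := rstar_sub_le hM (hρ.trans_le ht.1) ht.2
  refine ⟨hρ.trans_le ht.1, ?_, ?_, ?_⟩ <;> simp only <;> linarith [ht.2]

theorem initial_mem {M : ℝ} (hM : 0 < M) {p : ℝ × ℝ} {ρ : ℝ} (hρ : M < ρ)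
    (h : p.1 - 2 * rstar M p.2 + 2 * rstar M ρ = ρ) {t : ℝ} (ht : t ∈ Icc ρ p.1) :
    (t, t) ∈ pastTriangle M p := by
  have h3 := rstar_sub_le hM hρ ht.1
  refine ⟨hρ.trans_le ht.1, le_rfl, ht.2, ?_⟩
  simp only; linarith

section Sides

variable {M : ℝ} {p : ℝ × ℝ} {f a b : ℝ × ℝ → ℝ}

theorem hasDerivWithinAt_ingoing (hM : 0 < M) (h1 : M < p.2)
    (hf : ∀ q ∈ pastTriangle M p, HasGrad f (a q) (b q) (pastTriangle M p) q) (t : ℝ)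
    (ht : t ∈ Icc p.2 p.1) :
    HasDerivWithinAt (fun t => f (p.1, t)) (b (p.1, t)) (Icc p.2 p.1) t := by
  have := (hf _ (ingoing_mem hM h1 ht)).along (hasDerivWithinAt_const t (Icc p.2 p.1) p.1)
    (hasDerivWithinAt_id t _) rfl (fun t ht => ingoing_mem hM h1 ht)
  simpa using this

theorem hasDerivWithinAt_outgoing (hM : 0 < M) {ρ : ℝ} (hρ : M < ρ)
    (h : p.1 - 2 * rstar M p.2 + 2 * rstar M ρ = ρ)
    (hf : ∀ q ∈ pastTriangle M p, HasGrad f (a q) (b q) (pastTriangle M p) q) (t : ℝ)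
    (ht : t ∈ Icc ρ p.2) :
    HasDerivWithinAt (fun t => f (p.1 - 2 * rstar M p.2 + 2 * rstar M t, t))
      (a (p.1 - 2 * rstar M p.2 + 2 * rstar M t, t) * (2 / metricD M t)
        + b (p.1 - 2 * rstar M p.2 + 2 * rstar M t, t)) (Icc ρ p.2) t := by
  have hd := (((hasDerivAt_rstar M t hM (hρ.trans_le ht.1)).const_mul 2).const_add
    (p.1 - 2 * rstar M p.2)).hasDerivWithinAt (s := Icc ρ p.2)
  have := (hf _ (outgoing_mem hM hρ h ht)).along hd
    (hasDerivWithinAt_id t _) rfl (fun t ht => outgoing_mem hM hρ h ht)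
  refine this.congr_deriv ?_
  ring

theorem hasDerivWithinAt_initial (hM : 0 < M) {ρ : ℝ} (hρ : M < ρ)
    (h : p.1 - 2 * rstar M p.2 + 2 * rstar M ρ = ρ)
    (hf : ∀ q ∈ pastTriangle M p, HasGrad f (a q) (b q) (pastTriangle M p) q) (t : ℝ)
    (ht : t ∈ Icc ρ p.1) :
    HasDerivWithinAt (fun t => f (t, t)) (a (t, t) + b (t, t)) (Icc ρ p.1) t := by
  have := (hf _ (initial_mem hM hρ h ht)).along (hasDerivWithinAt_id t (Icc ρ p.1))
    (hasDerivWithinAt_id t _) rfl (fun t ht => initial_mem hM hρ h ht)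
  simpa using this

end Sides

/-! ### The dual potential -/

theorem hasDerivAt_metricD_deriv {M r : ℝ} (hr : r ≠ 0) :
    HasDerivAt (metricD M) (deriv (metricD M) r) r :=
  (hasDerivAt_metricD hr).differentiableAt.hasDerivAt

/-- The stream function of a solution of the wave equation: the `1`-form
`r² (D Yφ + Tφ) dv - r² Yφ dr` is closed. -/
theorem exists_dual_potential {M : ℝ} {φ : ℝ → ℝ → ℝ} {K : Set (ℝ × ℝ)} (hK : Convex ℝ K)
    (hr : ∀ q ∈ K, q.2 ≠ 0) (hφ : ∀ q ∈ K, SmoothAt φ q) (hbox : ∀ q ∈ K, box M φ q.1 q.2 = 0) :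
    ∃ η : ℝ × ℝ → ℝ, ∀ q ∈ K,
      HasGrad η (q.2 ^ 2 * (metricD M q.2 * vfY φ q.1 q.2 + vfT φ q.1 q.2))
        (0 - q.2 ^ 2 * vfY φ q.1 q.2) K q := by
  refine exists_hasGrad_of_closed hK
    (a := fun q => q.2 ^ 2 * (metricD M q.2 * vfY φ q.1 q.2 + vfT φ q.1 q.2))
    (b := fun q => 0 - q.2 ^ 2 * vfY φ q.1 q.2)
    (fun q hq => (HasGrad.radial (hasDerivAt_pow 2 q.2)).mul
      (((HasGrad.radial (hasDerivAt_metricD_deriv (hr q hq))).mul (hφ q hq).vfY.hasGrad).add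
        (hφ q hq).vfT.hasGrad))
    (fun q hq => (HasGrad.radial (hasDerivAt_const q.2 (0 : ℝ))).sub
      ((HasGrad.radial (hasDerivAt_pow 2 q.2)).mul (hφ q hq).vfY.hasGrad)) ?_
  -- The difference of the two cross derivatives is `r² □φ`.
  intro q hq
  have h := hbox q hq
  have hr := hr q hq
  unfold box at h
  rw [(hφ q hq).vfT_vfY] at h ⊢
  field_simp at h
  simp
  linear_combination h * q.2

/-! ### Pointwise boundedness of `r φ` -/

/-- The first term is the energy flux density, up to the factor `2k`; the second is integrable in
`ρ` at infinity. -/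
theorem abs_le_of_am_gm {x k D ρ : ℝ} (hk : 0 < k) (hD : 0 < D) (hD1 : D ≤ 1) (hρ : 0 < ρ) :
    |x / ρ| ≤ x ^ 2 / (k * D) + k / (4 * ρ ^ 2) := by
  have h1 : k * D / (4 * ρ ^ 2) ≤ k / (4 * ρ ^ 2) := by
    gcongr
    nlinarith
  have h2 : |x / ρ| ≤ x ^ 2 / (k * D) + k * D / (4 * ρ ^ 2) := by
    rw [abs_div, abs_of_pos hρ, ← sq_abs x]
    have : |x| ^ 2 / (k * D) + k * D / (4 * ρ ^ 2) - |x| / ρ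
        = (|x| - k * D / (2 * ρ)) ^ 2 / (k * D) := by
      field_simp
      ring
    have h3 : 0 ≤ (|x| - k * D / (2 * ρ)) ^ 2 / (k * D) := by positivity
    linarith
  linarith

/-- Uniform boundedness of `r φ` for solutions of the linear wave equation. On the initial
hypersurface `W = r² φ - η`, where `η` is the dual potential that equals `r² φ` on the horizon. -/
theorem abs_mul_le_of_box_eq_zero {M : ℝ} (hM : 0 < M) {φ : ℝ → ℝ → ℝ} {p : ℝ × ℝ} (h1 : M < p.2)
    (h2 : p.2 ≤ p.1) (hφ : ∀ q ∈ pastTriangle M p, SmoothAt φ q)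
    (hbox : ∀ q ∈ pastTriangle M p, box M φ q.1 q.2 = 0) {k : ℝ} (hk : 0 < k) {W : ℝ → ℝ}
    (hW : ∀ ρ, M < ρ → HasDerivAt W
      (2 * ρ * φ ρ ρ + 2 * ρ ^ 2 * vfY φ ρ ρ - ρ ^ 2 * metricD M ρ * vfY φ ρ ρ) ρ)
    (hWb : ∀ ρ, M < ρ → |W ρ| ≤ k * (ρ - M) / ρ) (hφb : ∀ ρ, M < ρ → |φ ρ ρ| ≤ k / ρ ^ 2) :
    |p.2 * φ p.1 p.2| ≤ 9 * k / M := by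
  set K := pastTriangle M p with hKdef
  have hKM : ∀ q ∈ K, M < q.2 := fun q hq => hq.1
  have hK0 : ∀ q ∈ K, 0 < q.2 := fun q hq => hM.trans (hKM q hq)
  obtain ⟨η₀, hη₀⟩ := exists_dual_potential (convex_pastTriangle hM p)
    (fun q hq => (hK0 q hq).ne') hφ hbox
  obtain ⟨A, hA1, hA2, hA3⟩ := exists_initial_point hM h1 h2
  have hA0 := hM.trans hA1
  obtain ⟨η, hη, hηW⟩ : ∃ η : ℝ × ℝ → ℝ, (∀ q ∈ K,
      HasGrad η (q.2 ^ 2 * (metricD M q.2 * vfY φ q.1 q.2 + vfT φ q.1 q.2))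
        (0 - q.2 ^ 2 * vfY φ q.1 q.2) K q) ∧
      ∀ t ∈ Icc A p.1, t ^ 2 * φ t t - η (t, t) = W t := by
    -- The free constant of the potential is chosen so that `r²φ - η = W` at the corner `A`; both
    -- sides have the same derivative along `{v = r}`, so they agree on the whole initial side.
    set c := A ^ 2 * φ A A - W A - η₀ (A, A) with hc
    have hη : ∀ q ∈ K, HasGrad (fun q => η₀ q + c)
        (q.2 ^ 2 * (metricD M q.2 * vfY φ q.1 q.2 + vfT φ q.1 q.2))
        (0 - q.2 ^ 2 * vfY φ q.1 q.2) K q := fun q hq =>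
      ((hη₀ q hq).add (HasGrad.radial (hasDerivAt_const q.2 c))).congr_grad
        (add_zero _) (add_zero _)
    refine ⟨fun q => η₀ q + c, hη, fun t ht => ?_⟩
    have hd : ∀ s ∈ Icc A t, HasDerivWithinAt (fun s => s ^ 2 * φ s s - (η₀ (s, s) + c) - W s) 0
        (Icc A t) s := by
      intro s hs
      have hs' : s ∈ Icc A p.1 := ⟨hs.1, hs.2.trans ht.2⟩
      have e1 := hasDerivWithinAt_initial hM hA1 hA3 hη s hs'
      have e2 := hasDerivWithinAt_initial hM hA1 hA3
        (f := fun q => q.2 ^ 2 * φ q.1 q.2) (fun q hq =>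
        (HasGrad.radial (hasDerivAt_pow 2 q.2)).mul (hφ q hq).hasGrad) s hs'
      have e3 := (hW s (hA1.trans_le hs.1)).hasDerivWithinAt (s := Icc A p.1)
      refine (((e2.sub e1).sub e3).mono (Icc_subset_Icc_right ht.2)).congr_deriv ?_
      simp
      ring
    have := eq_of_hasDerivWithinAt_zero ht.1 hd
    simp only [hc] at this ⊢
    linarith
  -- In terms of a time integral `Φ` of `φ`, these are `2r ∂_vΦ` and `2r ∂_uΦ`.
  set P : ℝ × ℝ → ℝ := fun q => q.2 * φ q.1 q.2 + η q * q.2⁻¹ with hP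
  set Q : ℝ × ℝ → ℝ := fun q => q.2 * φ q.1 q.2 - η q * q.2⁻¹ with hQ
  have hinv : ∀ q ∈ K, HasGrad (fun q : ℝ × ℝ => q.2⁻¹) 0 (-(q.2 ^ 2)⁻¹) K q := fun q hq =>
    HasGrad.radial (hasDerivAt_inv (hK0 q hq).ne')
  have hPg : ∀ q ∈ K, HasGrad P (2 * q.2 * vfT φ q.1 q.2 + q.2 * metricD M q.2 * vfY φ q.1 q.2)
      (Q q / q.2) K q := fun q hq => by
    have := hK0 q hq
    refine (((HasGrad.radial (hasDerivAt_id q.2)).mul (hφ q hq).hasGrad).add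
      ((hη q hq).mul (hinv q hq))).congr_grad ?_ ?_
    · simp; field_simp; ring
    · simp [hQ]; field_simp; ring
  have hQg : ∀ q ∈ K, HasGrad Q (-(q.2 * metricD M q.2 * vfY φ q.1 q.2))
      (P q / q.2 + 2 * q.2 * vfY φ q.1 q.2) K q := fun q hq => by
    have := hK0 q hq
    refine (((HasGrad.radial (hasDerivAt_id q.2)).mul (hφ q hq).hasGrad).sub
      ((hη q hq).mul (hinv q hq))).congr_grad ?_ ?_
    · simp; field_simp; ring
    · simp [hP]; field_simp; ring
  have hDpos : ∀ q ∈ K, 0 < metricD M q.2 := fun q hq => metricD_pos hM (hKM q hq)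
  -- Conservation of the `T`-energy of `Φ`: both cross derivatives equal `-4 r Q Yφ`.
  obtain ⟨E, hE⟩ : ∃ E : ℝ × ℝ → ℝ, ∀ q ∈ K,
      HasGrad E (P q * P q - Q q * Q q) (2 * (metricD M q.2)⁻¹ * (Q q * Q q)) K q := by
    refine exists_hasGrad_of_closed (convex_pastTriangle hM p)
      (fun q hq => ((hPg q hq).mul (hPg q hq)).sub ((hQg q hq).mul (hQg q hq)))
      (fun q hq => (HasGrad.radial (((hasDerivAt_metricD_deriv (hK0 q hq).ne').inv
        (hDpos q hq).ne').const_mul 2)).mul ((hQg q hq).mul (hQg q hq))) ?_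
    intro q hq
    have := hK0 q hq
    have := hDpos q hq
    simp only [Pi.inv_apply]
    field_simp
    ring
  -- The factor `t - M` is kept because it cancels the `1/D` in the initial energy density.
  have hQb : ∀ t ∈ Icc A p.1, |Q (t, t)| ≤ k * (t - M) / t ^ 2 := fun t ht => by
    have h0 : 0 < t := hA0.trans_le ht.1
    have e : Q (t, t) = W t / t := by
      simp only [hQ]
      rw [← hηW t ht]
      field_simp
    rw [e, abs_div, abs_of_pos h0, div_le_iff₀ h0]
    refine (hWb t (hA1.trans_le ht.1)).trans (le_of_eq ?_)
    field_simp
  have hQb' : ∀ t ∈ Icc A p.1, |Q (t, t)| ≤ k / t := fun t ht => by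
    have h0 : 0 < t := hA0.trans_le ht.1
    refine (hQb t ht).trans ?_
    rw [div_le_div_iff₀ (by positivity) h0]
    nlinarith [mul_pos hk h0, mul_pos (mul_pos hk hM) h0]
  have hPb : ∀ t ∈ Icc A p.1, |P (t, t)| ≤ 3 * k / t := fun t ht => by
    have h0 : 0 < t := hA0.trans_le ht.1
    have e : P (t, t) = 2 * t * φ t t - Q (t, t) := by simp only [hP, hQ]; ring
    rw [e]
    refine (abs_sub _ _).trans ?_
    have h3 : |2 * t * φ t t| ≤ 2 * t * (k / t ^ 2) := by
      rw [abs_mul, abs_of_pos (by positivity : 0 < 2 * t)]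
      gcongr
      exact hφb t (hA1.trans_le ht.1)
    have h4 := hQb' t ht
    have : 2 * t * (k / t ^ 2) + k / t = 3 * k / t := by field_simp; ring
    linarith
  have hDt : ∀ t, M < t → 0 < metricD M t := fun t ht => metricD_pos hM ht
  have hDt1 : ∀ t, M < t → metricD M t ≤ 1 := fun t ht => metricD_le_one hM ht.le
  have hrad : ∀ c t : ℝ, 0 < t → HasDerivAt (fun t : ℝ => -(c * t⁻¹)) (c / t ^ 2) t := by
    intro c t ht
    refine ((hasDerivAt_inv ht.ne').const_mul c).neg.congr_deriv ?_
    field_simp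
  have hAv : A ≤ p.1 := hA2.trans h2
  -- Along `{v = r}` the density is `P² - Q² + 2 Q²/D ≤ (9 + 2) k²/t²`.
  have hEinit : E (p.1, p.1) - E (A, A) ≤ 11 * k ^ 2 / M := by
    have h3 := abs_sub_le_sub_of_abs_deriv_le hAv (hasDerivWithinAt_initial hM hA1 hA3 hE)
      (fun t ht => (hrad (11 * k ^ 2) t (hA0.trans_le ht.1)).hasDerivWithinAt) ?_
    · have h4 := (abs_le.1 h3).2
      have h5 : 11 * k ^ 2 * A⁻¹ ≤ 11 * k ^ 2 / M := by
        rw [div_eq_mul_inv]; gcongr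
      have h6 : 0 ≤ 11 * k ^ 2 * p.1⁻¹ := by
        have := hA0.trans_le hAv
        positivity
      linarith
    · intro t ht
      have h0 : 0 < t := hA0.trans_le ht.1
      have htM := hA1.trans_le ht.1
      have hD := hDt t htM
      have h4 : P (t, t) * P (t, t) ≤ (3 * k / t) * (3 * k / t) := by
        rw [← abs_mul_abs_self]
        exact mul_self_le_mul_self (abs_nonneg _) (hPb t ht)
      have h5 : (metricD M t)⁻¹ * (Q (t, t) * Q (t, t)) ≤ k ^ 2 / t ^ 2 := by
        have : Q (t, t) * Q (t, t) ≤ (k * (t - M) / t ^ 2) * (k * (t - M) / t ^ 2) := by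
          rw [← abs_mul_abs_self]
          exact mul_self_le_mul_self (abs_nonneg _) (hQb t ht)
        rw [inv_mul_le_iff₀ hD]
        refine this.trans (le_of_eq ?_)
        rw [metricD_eq h0.ne']
        field_simp
      have h6 : Q (t, t) * Q (t, t) ≤ (metricD M t)⁻¹ * (Q (t, t) * Q (t, t)) :=
        le_mul_of_one_le_left (mul_self_nonneg _) (one_le_inv₀ hD |>.2 (hDt1 t htM))
      have h7 : (3 * k / t) * (3 * k / t) + 2 * (k ^ 2 / t ^ 2) = 11 * k ^ 2 / t ^ 2 := by
        field_simp; ring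
      rw [abs_le]
      constructor
      · have : 0 ≤ 11 * k ^ 2 / t ^ 2 := by positivity
        have := mul_self_nonneg (P (t, t))
        have := mul_self_nonneg (Q (t, t))
        linarith
      · have := mul_self_nonneg (Q (t, t))
        linarith
  -- Ingoing side: `P_r = Q/r` and `E_r = 2 Q²/D`, so `E/(2k)` is a primitive of the first term of
  -- the AM-GM bound.
  have hin := abs_sub_le_sub_of_abs_deriv_le h2 (hasDerivWithinAt_ingoing hM h1 hPg)
    (fun t ht => ((hasDerivWithinAt_ingoing hM h1 hE t ht).const_mul (1 / (2 * k))).add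
      ((hrad (k / 4) t ((hM.trans h1).trans_le ht.1)).hasDerivWithinAt)) (by
      intro t ht
      have h0 := (hM.trans h1).trans_le ht.1
      have hD := hDt t (h1.trans_le ht.1)
      refine (abs_le_of_am_gm (x := Q (p.1, t)) hk hD (hDt1 t (h1.trans_le ht.1)) h0).trans
        (le_of_eq ?_)
      simp only
      field_simp)
  have hout := abs_sub_le_sub_of_abs_deriv_le hA2 (hasDerivWithinAt_outgoing hM hA1 hA3 hQg)
    (fun t ht => ((hasDerivWithinAt_outgoing hM hA1 hA3 hE t ht).const_mul (1 / (2 * k))).add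
      ((hrad (k / 4) t (hA0.trans_le ht.1)).hasDerivWithinAt)) (by
      intro t ht
      have h0 := hA0.trans_le ht.1
      have hD := hDt t (hA1.trans_le ht.1)
      set q : ℝ × ℝ := (p.1 - 2 * rstar M p.2 + 2 * rstar M t, t) with hq
      -- The terms in `Yφ` cancel exactly in the outgoing direction, leaving `dQ/dr = P/r`.
      have e : -(q.2 * metricD M q.2 * vfY φ q.1 q.2) * (2 / metricD M t)
          + (P q / q.2 + 2 * q.2 * vfY φ q.1 q.2) = P q / t := by
        simp only [hq]
        field_simp
        ring
      rw [e]
      refine (abs_le_of_am_gm (x := P q) hk hD (hDt1 t (hA1.trans_le ht.1)) h0).trans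
        (le_of_eq ?_)
      simp only [hq]
      field_simp
      ring)
  -- The fluxes through the two null sides are nonnegative and add up to the initial energy, so each
  -- is at most `11 k²/M`.
  have hEin := le_of_hasDerivWithinAt_nonneg h2 (hasDerivWithinAt_ingoing hM h1 hE) (by
    intro t ht
    have hD := hDt t (h1.trans_le ht.1)
    have := mul_self_nonneg (Q (p.1, t))
    positivity)
  have hEout := le_of_hasDerivWithinAt_nonneg hA2 (hasDerivWithinAt_outgoing hM hA1 hA3 hE) (by
    intro t ht
    have hD := hDt t (hA1.trans_le ht.1)
    set q : ℝ × ℝ := (p.1 - 2 * rstar M p.2 + 2 * rstar M t, t) with hq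
    have e : (P q * P q - Q q * Q q) * (2 / metricD M t)
        + 2 * (metricD M q.2)⁻¹ * (Q q * Q q) = 2 * (metricD M t)⁻¹ * (P q * P q) := by
      simp only [hq]
      field_simp
      ring
    rw [e]
    have := mul_self_nonneg (P q)
    positivity)
  simp only [Pi.add_apply] at hin hout
  have eA : p.1 - 2 * rstar M p.2 + 2 * rstar M A = A := hA3
  have eP : p.1 - 2 * rstar M p.2 + 2 * rstar M p.2 = p.1 := by ring
  simp only [eA, eP] at hout hEout
  have hB : |P (p.1, p.1)| ≤ 3 * k / M := (hPb p.1 ⟨hAv, le_rfl⟩).trans (by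
    have := hA1.le.trans hAv
    gcongr)
  have hQA : |Q (A, A)| ≤ k / M := (hQb' A ⟨le_rfl, hAv⟩).trans (by gcongr)
  -- Flux and remainder contribute `11/2 + 1/4 ≤ 6` multiples of `k/M`.
  have hfin : ∀ x y e e' : ℝ, M ≤ x → x ≤ y → e - e' ≤ 11 * k ^ 2 / M →
      1 / (2 * k) * e + -(k / 4 * y⁻¹) - (1 / (2 * k) * e' + -(k / 4 * x⁻¹)) ≤ 6 * k / M := by
    intro x y e e' hx hxy he
    have i1 : x⁻¹ ≤ M⁻¹ := inv_anti₀ hM hx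
    have i2 : 0 ≤ y⁻¹ := inv_nonneg.2 ((hM.le.trans hx).trans hxy)
    have i3 : 1 / (2 * k) * (e - e') ≤ 1 / (2 * k) * (11 * k ^ 2 / M) := by gcongr
    have i4 : 1 / (2 * k) * (11 * k ^ 2 / M) = 11 / 2 * (k * M⁻¹) := by field_simp
    have i5 : k / 4 * x⁻¹ ≤ k / 4 * M⁻¹ := by gcongr
    have i6 : 0 ≤ k / 4 * y⁻¹ := by positivity
    have i7 : 0 ≤ k * M⁻¹ := by positivity
    have i8 : 6 * k / M = 6 * (k * M⁻¹) := by rw [div_eq_mul_inv, mul_assoc]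
    rw [i8]
    linarith
  have hin' := hin.trans (hfin _ _ _ _ h1.le h2 (by linarith))
  have hout' := hout.trans (hfin _ _ _ _ hA1.le hA2 (by linarith))
  have e : p.2 * φ p.1 p.2 = (P (p.1, p.2) + Q (p.1, p.2)) / 2 := by
    simp only [hP, hQ]; ring
  rw [e]
  have e9 : 9 * k / M = 3 * k / M + 6 * k / M := by ring
  have e3 : 3 * k / M = k / M + 2 * (k / M) := by ring
  have : 0 < k / M := by positivity
  rw [abs_le] at hin' hout' hB hQA ⊢
  constructor <;> linarith

/-! ### Transport along null rays -/

/-- Transport of `Y (r φ)` along outgoing null rays. -/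
theorem abs_vfY_mul_le_of_box_eq_zero {M : ℝ} (hM : 0 < M) {φ : ℝ → ℝ → ℝ} {p : ℝ × ℝ}
    (h1 : M < p.2) (h2 : p.2 ≤ p.1) (hφ : ∀ q ∈ pastTriangle M p, SmoothAt φ q)
    (hbox : ∀ q ∈ pastTriangle M p, box M φ q.1 q.2 = 0) {m : ℝ}
    (hm : ∀ q ∈ pastTriangle M p, |φ q.1 q.2| ≤ m)
    (hmA : ∀ ρ, M < ρ → |φ ρ ρ + ρ * vfY φ ρ ρ| ≤ m) :
    |φ p.1 p.2 + p.2 * vfY φ p.1 p.2| ≤ m := by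
  obtain ⟨A, hA1, hA2, hA3⟩ := exists_initial_point hM h1 h2
  have hK0 : ∀ q ∈ pastTriangle M p, 0 < q.2 := fun q hq => hM.trans hq.1
  have hg := fun t ht => hasDerivWithinAt_outgoing hM hA1 hA3 (fun q hq =>
    (HasGrad.radial (hasDerivAt_metricD_deriv (M := M) (hK0 q hq).ne')).mul
      ((hφ q hq).hasGrad.add
        ((HasGrad.radial (hasDerivAt_id q.2)).mul (hφ q hq).vfY.hasGrad))) t ht
  have h3 := abs_sub_le_sub_of_abs_deriv_le hA2 hg
    (fun t ht => ((hasDerivAt_metricD_deriv (M := M)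
      (hM.trans (hA1.trans_le ht.1)).ne').const_mul m).hasDerivWithinAt) (by
    intro t ht
    have htM := hA1.trans_le ht.1
    have hD := metricD_pos hM htM
    have ht0 := hM.trans htM
    have hq := outgoing_mem hM hA1 hA3 ht
    have hb := hbox _ hq
    unfold box at hb
    simp only [id] at hb ⊢
    set v := p.1 - 2 * rstar M p.2 + 2 * rstar M t
    have e : (0 * (φ v t + t * vfY φ v t) +
        metricD M t * (vfT φ v t + (0 * vfY φ v t + t * vfT (vfY φ) v t))) * (2 / metricD M t)
        + (deriv (metricD M) t * (φ v t + t * vfY φ v t) +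
        metricD M t * (vfY φ v t + (1 * vfY φ v t + t * vfY (vfY φ) v t)))
        = φ v t * deriv (metricD M) t := by
      field_simp at hb ⊢
      linear_combination metricD M t * hb
    rw [e, abs_mul, abs_of_nonneg (deriv_metricD_nonneg hM htM.le)]
    exact mul_le_mul_of_nonneg_right (hm _ hq) (deriv_metricD_nonneg hM htM.le))
  have eP : p.1 - 2 * rstar M p.2 + 2 * rstar M p.2 = p.1 := by ring
  simp only [hA3, eP, id] at h3
  have hDA := metricD_pos hM hA1
  have hDP := metricD_pos hM h1
  have h4 : |metricD M A * (φ A A + A * vfY φ A A)| ≤ m * metricD M A := by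
    rw [abs_mul, abs_of_pos hDA, mul_comm]
    exact mul_le_mul_of_nonneg_right (hmA A hA1) hDA.le
  -- The initial value contributes `m D(A)` and the ray `m (D(r) - D(A))`; the sum is `m D(r)`, so
  -- `D(r)` divides out.
  have h5 : |metricD M p.2 * (φ p.1 p.2 + p.2 * vfY φ p.1 p.2)| ≤ metricD M p.2 * m := by
    rw [abs_le] at h3 h4 ⊢
    constructor <;> linarith
  rw [abs_mul, abs_of_pos hDP] at h5
  exact le_of_mul_le_mul_left h5 hDP

/-- Transport of `∂_v (r φ)` along ingoing null rays. -/
theorem abs_nullDv_mul_le_of_box_eq_zero {M : ℝ} (hM : 0 < M) {φ : ℝ → ℝ → ℝ} {p : ℝ × ℝ}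
    (h1 : M < p.2) (h2 : p.2 ≤ p.1) (hφ : ∀ q ∈ pastTriangle M p, SmoothAt φ q)
    (hbox : ∀ q ∈ pastTriangle M p, box M φ q.1 q.2 = 0) {m c : ℝ} (hm0 : 0 ≤ m) (hc : 0 ≤ c)
    (hm : ∀ q ∈ pastTriangle M p, |φ q.1 q.2| ≤ m / q.2)
    (hcB : ∀ ρ, M < ρ → |ρ * vfT φ ρ ρ + metricD M ρ * (φ ρ ρ + ρ * vfY φ ρ ρ) / 2| ≤ c / ρ ^ 2) :
    |p.2 * vfT φ p.1 p.2 + metricD M p.2 * (φ p.1 p.2 + p.2 * vfY φ p.1 p.2) / 2|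
      ≤ (c + M * m / 2) / p.2 ^ 2 := by
  have hK0 : ∀ q ∈ pastTriangle M p, 0 < q.2 := fun q hq => hM.trans hq.1
  have hg := fun t ht => hasDerivWithinAt_ingoing hM h1 (fun q hq =>
    ((HasGrad.radial (hasDerivAt_id q.2)).mul (hφ q hq).vfT.hasGrad).add
    (((HasGrad.radial (hasDerivAt_metricD_deriv (M := M) (hK0 q hq).ne')).mul
      ((hφ q hq).hasGrad.add
        ((HasGrad.radial (hasDerivAt_id q.2)).mul (hφ q hq).vfY.hasGrad))).mul
        (HasGrad.radial (hasDerivAt_const q.2 (1 / 2 : ℝ))))) t ht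
  have hp0 := hM.trans h1
  have h3 := abs_sub_le_sub_of_abs_deriv_le h2 hg
    (g := fun t => -(M * m / 2 * (t ^ 2)⁻¹)) (g' := fun t => M * m / t ^ 3)
    (fun t ht => by
      have ht0 := hp0.trans_le ht.1
      refine (((hasDerivAt_pow 2 t).inv (by positivity)).const_mul
        (M * m / 2)).neg.hasDerivWithinAt.congr_deriv ?_
      simp
      field_simp) (by
    intro t ht
    have htM := h1.trans_le ht.1
    have ht0 := hM.trans htM
    have hq := ingoing_mem hM h1 ht
    have hb := hbox _ hq
    unfold box at hb
    have hc := (hφ _ hq).vfT_vfY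
    simp only [id] at hb hc ⊢
    set v := p.1
    rw [hc] at hb
    have e : 1 * vfT φ v t + t * vfY (vfT φ) v t + ((deriv (metricD M) t *
        (φ v t + t * vfY φ v t) + metricD M t * (vfY φ v t + (1 * vfY φ v t +
          t * vfY (vfY φ) v t))) * (1 / 2) + metricD M t * (φ v t + t * vfY φ v t) * 0)
        = φ v t * (deriv (metricD M) t / 2) := by
      field_simp at hb ⊢
      linear_combination hb
    rw [e, abs_mul, abs_of_nonneg (div_nonneg (deriv_metricD_nonneg hM htM.le) zero_le_two)]
    calc |φ v t| * (deriv (metricD M) t / 2) ≤ m / t * (2 * M / t ^ 2 / 2) := by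
          gcongr
          · exact div_nonneg (deriv_metricD_nonneg hM htM.le) zero_le_two
          · exact hm _ hq
          · exact deriv_metricD_le hM htM.le
      _ = M * m / t ^ 3 := by field_simp)
  have h4 := hcB p.1 (h1.trans_le h2)
  have h5 : c / p.1 ^ 2 ≤ c / p.2 ^ 2 := by gcongr
  have h6 : 0 ≤ M * m / 2 * (p.1 ^ 2)⁻¹ := by positivity
  have e : (c + M * m / 2) / p.2 ^ 2 = c / p.2 ^ 2 + M * m / 2 * (p.2 ^ 2)⁻¹ := by
    rw [add_div, div_eq_mul_inv (M * m / 2)]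
  rw [e]
  simp only [id, mul_one_div] at h3
  rw [abs_le] at h3 h4 ⊢
  constructor <;> linarith

/-! ### Pointwise bounds for the linear wave equation -/

/-- Initial data on `{v = r}` bounded by `k` and supported in `{r ≤ R₀}`. -/
structure DataBound (M R₀ k : ℝ) (φ : ℝ → ℝ → ℝ) : Prop where
  contφ : ContinuousOn (fun r => φ r r) (Ici M)
  contY : ContinuousOn (fun r => vfY φ r r) (Ici M)
  boundφ : ∀ r, M ≤ r → r ≤ R₀ → |φ r r| ≤ k
  boundY : ∀ r, M ≤ r → r ≤ R₀ → |vfY φ r r| ≤ k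
  boundT : ∀ r, M ≤ r → r ≤ R₀ → |vfT φ r r| ≤ k
  zeroφ : ∀ r, R₀ < r → φ r r = 0
  zeroY : ∀ r, R₀ < r → vfY φ r r = 0
  zeroT : ∀ r, R₀ < r → vfT φ r r = 0

/-- The integral from the horizon of the data that determines the dual potential. -/
theorem DataBound.exists_primitive {M R₀ k : ℝ} (hM : 0 < M) (hR₀ : 2 * M < R₀) (hk : 0 < k)
    {φ : ℝ → ℝ → ℝ} (h : DataBound M R₀ k φ) :
    ∃ W : ℝ → ℝ, (∀ ρ, M < ρ → HasDerivAt W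
      (2 * ρ * φ ρ ρ + 2 * ρ ^ 2 * vfY φ ρ ρ - ρ ^ 2 * metricD M ρ * vfY φ ρ ρ) ρ) ∧
      ∀ ρ, M < ρ → |W ρ| ≤ (2 * R₀ * (2 * R₀ + 2 * R₀ ^ 2) * k) * (ρ - M) / ρ := by
  set w : ℝ → ℝ := fun ρ => 2 * ρ * φ ρ ρ + 2 * ρ ^ 2 * vfY φ ρ ρ - ρ ^ 2 * metricD M ρ * vfY φ ρ ρ
    with hw
  have hwc : ContinuousOn w (Ici M) := by
    have hD : ContinuousOn (metricD M) (Ici M) := fun r hr =>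
      (contDiffAt_metricD (hM.trans_le hr).ne').continuousAt.continuousWithinAt
    exact (((by fun_prop : Continuous fun ρ : ℝ => 2 * ρ).continuousOn.mul h.contφ).add
      ((by fun_prop : Continuous fun ρ : ℝ => 2 * ρ ^ 2).continuousOn.mul h.contY)).sub
      (((by fun_prop : Continuous fun ρ : ℝ => ρ ^ 2).continuousOn.mul hD).mul h.contY)
  -- The integrand is frozen below `M`, since continuity of the data is only known on `r ≥ M`.
  have hwext : Continuous (fun x => w (max x M)) :=
    hwc.comp_continuous (by fun_prop) (fun x => mem_Ici.2 (le_max_right _ _))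
  have hR0 : 0 < R₀ := by linarith
  set c := (2 * R₀ + 2 * R₀ ^ 2) * k with hc
  have hc0 : 0 < c := by positivity
  have hw0 : ∀ x, R₀ < x → w x = 0 := fun x hx => by simp [hw, h.zeroφ x hx, h.zeroY x hx]
  have hwb : ∀ x, M ≤ x → |w x| ≤ c := fun x hx => by
    rcases le_or_gt x R₀ with hxR | hxR
    · have hx0 := hM.trans_le hx
      have e : w x = 2 * x * φ x x + (2 - metricD M x) * (x ^ 2 * vfY φ x x) := by
        simp only [hw]; ring
      have hD0 := metricD_nonneg M x
      have hD1 := metricD_le_one hM hx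
      have i1 : |2 * x * φ x x| ≤ 2 * R₀ * k := by
        rw [abs_mul, abs_of_pos (by positivity : 0 < 2 * x)]
        gcongr
        exact h.boundφ x hx hxR
      have i2 : |(2 - metricD M x) * (x ^ 2 * vfY φ x x)| ≤ 2 * (R₀ ^ 2 * k) := by
        rw [abs_mul, abs_mul, abs_of_nonneg (by linarith : 0 ≤ 2 - metricD M x),
          abs_of_nonneg (sq_nonneg x)]
        gcongr
        · linarith
        · exact h.boundY x hx hxR
      rw [e]
      refine (abs_add_le _ _).trans ?_
      rw [hc]
      linarith
    · rw [hw0 x hxR, abs_zero]; exact hc0.le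
  have hWd : ∀ ρ, HasDerivAt (fun ρ => ∫ x in M..ρ, w (max x M)) (w (max ρ M)) ρ := fun ρ =>
    intervalIntegral.integral_hasDerivAt_right (hwext.intervalIntegrable _ _)
      (hwext.stronglyMeasurableAtFilter _ _) hwext.continuousAt
  have hlin : ∀ ρ, M ≤ ρ → |∫ x in M..ρ, w (max x M)| ≤ c * (ρ - M) := fun ρ hρ => by
    have := intervalIntegral.norm_integral_le_of_norm_le_const (a := M) (b := ρ) (C := c)
      (f := fun x => w (max x M)) (fun x _ => hwb _ (le_max_right _ _))
    rwa [abs_of_nonneg (sub_nonneg.2 hρ), Real.norm_eq_abs] at this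
  refine ⟨fun ρ => ∫ x in M..ρ, w (max x M), fun ρ hρ => ?_, fun ρ hρ => ?_⟩
  · have := hWd ρ
    rwa [max_eq_left hρ.le] at this
  · have hρ0 := hM.trans hρ
    have hρM := sub_pos.2 hρ
    rw [show 2 * R₀ * (2 * R₀ + 2 * R₀ ^ 2) * k = 2 * R₀ * c by rw [hc]; ring, le_div_iff₀ hρ0]
    simp only
    rcases le_or_gt ρ R₀ with hρR | hρR
    · calc _ ≤ c * (ρ - M) * ρ := by gcongr; exact hlin ρ hρ.le
        _ ≤ c * (ρ - M) * (2 * R₀) := by gcongr; linarith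
        _ = _ := by ring
    · have e : ∫ x in M..ρ, w (max x M) = ∫ x in M..R₀, w (max x M) := by
        rw [← intervalIntegral.integral_add_adjacent_intervals
          (hwext.intervalIntegrable M R₀) (hwext.intervalIntegrable R₀ ρ)]
        have : ∫ x in R₀..ρ, w (max x M) = ∫ x in R₀..ρ, (0 : ℝ) := by
          refine intervalIntegral.integral_congr_ae (Eventually.of_forall fun x hx => ?_)
          rw [uIoc_of_le hρR.le] at hx
          have hMx : M ≤ x := by linarith [hx.1]
          rw [max_eq_left hMx, hw0 x hx.1]
        rw [this]
        simp
      rw [e]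
      -- Beyond the support `W` is constant; `2M < R₀ < ρ` gives `ρ ≤ 2 (ρ - M)`.
      calc _ ≤ c * (R₀ - M) * ρ := by gcongr; exact hlin R₀ (by linarith)
        _ ≤ c * R₀ * (2 * (ρ - M)) := by gcongr <;> linarith
        _ = _ := by ring

theorem exists_linear_bound {M R₀ : ℝ} (hM : 0 < M) (hR₀ : 2 * M < R₀) :
    ∃ L : ℝ, 0 < L ∧ ∀ (k : ℝ) (φ : ℝ → ℝ → ℝ) (p : ℝ × ℝ), 0 < k → M < p.2 → p.2 ≤ p.1 →
      (∀ q ∈ pastTriangle M p, SmoothAt φ q) →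
      (∀ q ∈ pastTriangle M p, box M φ q.1 q.2 = 0) → DataBound M R₀ k φ →
      |φ p.1 p.2| ≤ L * k ∧ |p.2 * φ p.1 p.2| ≤ L * k ∧ |vfY φ p.1 p.2| ≤ L * k ∧
        |p.2 ^ 2 * nullDv M φ p.1 p.2| ≤ L * k := by
  have hR0 : 0 < R₀ := by linarith
  -- The two summands serve the hypotheses `|φ| ≤ k/ρ²` and `|W| ≤ k (ρ - M)/ρ` of the bound on
  -- `rφ`.
  set d := R₀ ^ 2 + 2 * R₀ * (2 * R₀ + 2 * R₀ ^ 2) with hd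
  have hd0 : 0 < d := by positivity
  set l := 9 * d / M with hl
  have hl0 : 0 < l := by positivity
  set m := l / M + (1 + R₀) with hm
  have hm0 : 0 < m := by positivity
  set c := R₀ ^ 2 * (2 * R₀ + 1) with hc
  have hc0 : 0 < c := by positivity
  set n := (c + M * l / 2) / M + l with hn
  have hn0 : 0 < n := by positivity
  refine ⟨m + l + 2 * m / M + n, by positivity, ?_⟩
  intro k φ p hk h1 h2 hφ hbox hdata
  obtain ⟨W, hW, hWb⟩ := hdata.exists_primitive hM hR₀ hk
  have hp0 := hM.trans h1
  have hmain : ∀ q ∈ pastTriangle M p, |q.2 * φ q.1 q.2| ≤ l * k := by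
    intro q hq
    have hsub := pastTriangle_subset hq
    have := abs_mul_le_of_box_eq_zero hM hq.1 hq.2.1 (fun x hx => hφ x (hsub hx))
      (fun x hx => hbox x (hsub hx)) (k := d * k) (by positivity) hW ?_ ?_
    · refine this.trans (le_of_eq ?_)
      rw [hl]; ring
    · intro ρ hρ
      refine (hWb ρ hρ).trans ?_
      have := sub_pos.2 hρ
      have := hM.trans hρ
      gcongr
      rw [hd]
      linarith [sq_nonneg R₀]
    · intro ρ hρ
      have := hM.trans hρ
      rcases le_or_gt ρ R₀ with h | h
      · rw [le_div_iff₀ (by positivity)]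
        calc |φ ρ ρ| * ρ ^ 2 ≤ k * R₀ ^ 2 := by
              gcongr
              exact hdata.boundφ ρ hρ.le h
          _ ≤ d * k := by
              rw [mul_comm]
              gcongr
              rw [hd]
              have : 0 ≤ 2 * R₀ * (2 * R₀ + 2 * R₀ ^ 2) := by positivity
              linarith
      · rw [hdata.zeroφ ρ h, abs_zero]; positivity
  have hφr : ∀ q ∈ pastTriangle M p, |φ q.1 q.2| ≤ l * k / q.2 := by
    intro q hq
    have h0 := hM.trans hq.1
    have := hmain q hq
    rw [abs_mul, abs_of_pos h0] at this
    rw [le_div_iff₀ h0]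
    linarith
  have hφm : ∀ q ∈ pastTriangle M p, |φ q.1 q.2| ≤ m * k := by
    intro q hq
    refine (hφr q hq).trans ?_
    have : l * k / q.2 ≤ l * k / M := by
      have := hq.1.le
      gcongr
    have e : m * k = l * k / M + (1 + R₀) * k := by rw [hm]; ring
    have : 0 < (1 + R₀) * k := by positivity
    linarith
  have hself := self_mem_pastTriangle h1 h2
  have hZ := abs_vfY_mul_le_of_box_eq_zero hM h1 h2 hφ hbox hφm (by
    intro ρ hρ
    have hρ0 := hM.trans hρ
    rcases le_or_gt ρ R₀ with h | h
    · have i1 := hdata.boundφ ρ hρ.le h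
      have i2 : |ρ * vfY φ ρ ρ| ≤ R₀ * k := by
        rw [abs_mul, abs_of_pos hρ0]
        gcongr
        exact hdata.boundY ρ hρ.le h
      refine (abs_add_le _ _).trans ?_
      have e : m * k = l / M * k + (k + R₀ * k) := by rw [hm]; ring
      have : 0 < l / M * k := by positivity
      linarith
    · rw [hdata.zeroφ ρ h, hdata.zeroY ρ h]
      simp only [mul_zero, add_zero, abs_zero]
      positivity)
  have hV := abs_nullDv_mul_le_of_box_eq_zero hM h1 h2 hφ hbox (m := l * k) (c := c * k)
    (by positivity) (by positivity) hφr (by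
    intro ρ hρ
    have hρ0 := hM.trans hρ
    rcases le_or_gt ρ R₀ with h | h
    · have hD0 := metricD_nonneg M ρ
      have hD1 := metricD_le_one hM hρ.le
      have i1 := hdata.boundφ ρ hρ.le h
      have i2 : |ρ * vfY φ ρ ρ| ≤ R₀ * k := by
        rw [abs_mul, abs_of_pos hρ0]
        gcongr
        exact hdata.boundY ρ hρ.le h
      have i3 : |ρ * vfT φ ρ ρ| ≤ R₀ * k := by
        rw [abs_mul, abs_of_pos hρ0]
        gcongr
        exact hdata.boundT ρ hρ.le h
      have i4 : |metricD M ρ * (φ ρ ρ + ρ * vfY φ ρ ρ) / 2| ≤ k + R₀ * k := by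
        rw [mul_div_assoc, abs_mul, abs_of_nonneg hD0, abs_div, abs_two]
        have := abs_add_le (φ ρ ρ) (ρ * vfY φ ρ ρ)
        have := abs_nonneg (φ ρ ρ + ρ * vfY φ ρ ρ)
        nlinarith
      rw [le_div_iff₀ (by positivity)]
      calc _ ≤ (R₀ * k + (k + R₀ * k)) * R₀ ^ 2 := by
            gcongr
            exact (abs_add_le _ _).trans (add_le_add i3 i4)
        _ = c * k := by rw [hc]; ring
    · rw [hdata.zeroφ ρ h, hdata.zeroY ρ h, hdata.zeroT ρ h]
      simp only [mul_zero, add_zero, abs_zero, zero_div]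
      positivity)
  have hφp := hφm p hself
  have hrφ := hmain p hself
  have j1 : 0 < m * k := by positivity
  have j2 : 0 < l * k := by positivity
  have j3 : 0 < n * k := by positivity
  have j4 : 0 < 2 * m / M * k := by positivity
  have e : (m + l + 2 * m / M + n) * k = m * k + l * k + 2 * m / M * k + n * k := by ring
  rw [e]
  refine ⟨by linarith, by linarith, ?_, ?_⟩
  · have : |p.2 * vfY φ p.1 p.2| ≤ 2 * (m * k) := by
      rw [abs_le] at hZ hφp ⊢
      constructor <;> linarith
    rw [abs_mul, abs_of_pos hp0] at this
    have i2 : M * |vfY φ p.1 p.2| ≤ 2 * (m * k) :=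
      (mul_le_mul_of_nonneg_right h1.le (abs_nonneg _)).trans this
    have i3 : |vfY φ p.1 p.2| ≤ 2 * (m * k) / M := by rwa [le_div_iff₀' hM]
    have : 2 * (m * k) / M = 2 * m / M * k := by ring
    linarith
  -- This is `r² ∂_vφ = r ∂_v(rφ) - (D/2) rφ`.
  · have e2 : p.2 ^ 2 * nullDv M φ p.1 p.2 = p.2 * (p.2 * vfT φ p.1 p.2 +
        metricD M p.2 * (φ p.1 p.2 + p.2 * vfY φ p.1 p.2) / 2)
        - metricD M p.2 / 2 * (p.2 * φ p.1 p.2) := by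
      unfold nullDv; ring
    have hD0 := metricD_nonneg M p.2
    have hD1 := metricD_le_one hM h1.le
    have i1 : |p.2 * (p.2 * vfT φ p.1 p.2 +
        metricD M p.2 * (φ p.1 p.2 + p.2 * vfY φ p.1 p.2) / 2)| ≤ (c + M * l / 2) / M * k := by
      rw [abs_mul, abs_of_pos hp0]
      calc _ ≤ p.2 * ((c * k + M * (l * k) / 2) / p.2 ^ 2) := by gcongr
        _ = (c + M * l / 2) * k / p.2 := by field_simp
        _ ≤ (c + M * l / 2) * k / M := by gcongr
        _ = _ := by ring
    have i2 : |metricD M p.2 / 2 * (p.2 * φ p.1 p.2)| ≤ l * k := by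
      rw [abs_mul, abs_of_nonneg (by linarith)]
      have := abs_nonneg (p.2 * φ p.1 p.2)
      nlinarith
    rw [e2]
    have e3 : n * k = (c + M * l / 2) / M * k + l * k := by rw [hn]; ring
    have := abs_sub (p.2 * (p.2 * vfT φ p.1 p.2 +
        metricD M p.2 * (φ p.1 p.2 + p.2 * vfY φ p.1 p.2) / 2))
        (metricD M p.2 / 2 * (p.2 * φ p.1 p.2))
    linarith

/-! ### The region -/

theorem le_nullV {M R₀ τ r : ℝ} (hM : 0 < M) (hR₀ : M < R₀) (hτ : 0 ≤ τ) (hr : R₀ ≤ r) :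
    r ≤ nullV M R₀ τ r := by
  have := rstar_sub_le hM hR₀ hr
  unfold nullV
  linarith

theorem le_of_mem_leafSigma {M R₀ τ : ℝ} (hM : 0 < M) (hR₀ : M < R₀) (hτ : 0 ≤ τ) {p : ℝ × ℝ}
    (hp : p ∈ leafSigma M R₀ τ) : M ≤ p.2 ∧ p.2 ≤ p.1 := by
  rcases hp with ⟨h1, h2, -⟩ | ⟨h1, h2⟩
  · exact ⟨h2, by linarith⟩
  · exact ⟨hR₀.le.trans h1, h2 ▸ le_nullV hM hR₀ hτ h1⟩

theorem mem_region_of_le {M R₀ τ : ℝ} {𝒯 : EReal} (hτ𝒯 : (τ : EReal) < 𝒯) {q : ℝ × ℝ}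
    (h1 : M ≤ q.2) (h2 : q.2 ≤ q.1) (h3 : q.2 ≤ R₀ → q.1 - q.2 ≤ τ)
    (h4 : R₀ ≤ q.2 → q.1 ≤ nullV M R₀ τ q.2) : q ∈ region M R₀ 𝒯 := by
  refine ⟨h1, sub_nonneg.2 h2, ?_⟩
  rcases le_total q.2 R₀ with h | h
  · exact ⟨q.1 - q.2, (EReal.coe_le_coe_iff.2 (h3 h)).trans_lt hτ𝒯, Or.inl ⟨rfl, h1, h⟩⟩
  · refine ⟨q.1 - R₀ - 2 * (rstar M q.2 - rstar M R₀),
      (EReal.coe_le_coe_iff.2 ?_).trans_lt hτ𝒯, Or.inr ⟨h, ?_⟩⟩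
    · have := h4 h
      unfold nullV at this
      linarith
    · unfold nullV
      ring

theorem initial_mem_region {M R₀ : ℝ} (hM : 0 < M) (hR₀ : M < R₀) {𝒯 : EReal} (h𝒯 : 0 < 𝒯) {r : ℝ}
    (hr : M ≤ r) : (r, r) ∈ region M R₀ 𝒯 :=
  mem_region_of_le (τ := 0) (by simpa using h𝒯) hr le_rfl (fun _ => by simp)
    (fun h => le_nullV hM hR₀ le_rfl h)

/-- Past-directed causal curves cannot cross a leaf upwards: on `S_τ` by monotonicity of `2 r* - r`,
on `N_τ` because `u` does not increase into the past. -/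
theorem pastTriangle_subset_region {M R₀ τ : ℝ} (hM : 0 < M) (hR₀ : M < R₀) {𝒯 : EReal}
    (hτ𝒯 : (τ : EReal) < 𝒯) {p : ℝ × ℝ} (hp : p ∈ leafSigma M R₀ τ) :
    pastTriangle M p ⊆ region M R₀ 𝒯 := by
  rintro q ⟨q1, q2, q3, q4⟩
  refine mem_region_of_le hτ𝒯 q1.le q2 (fun hq => ?_) (fun hq => ?_)
  · rcases hp with ⟨h1, h2, h3⟩ | ⟨h1, h2⟩
    · rcases le_total q.2 p.2 with h | h
      · have := rstar_sub_le hM q1 h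
        linarith
      · linarith
    · have := rstar_sub_le hM q1 hq
      unfold nullV at h2
      linarith
  · unfold nullV
    rcases hp with ⟨h1, h2, h3⟩ | ⟨h1, h2⟩
    · have := rstar_sub_le hM hR₀ hq
      linarith
    · unfold nullV at h2
      linarith

/-! ### Derivatives of the normal derivative -/

theorem HasGrad.vfT_vfY_eq {ψ : ℝ → ℝ → ℝ} {a b : ℝ} {p : ℝ × ℝ}
    (h : HasGrad (fun q => ψ q.1 q.2) a b univ p) : vfT ψ p.1 p.2 = a ∧ vfY ψ p.1 p.2 = b := by
  unfold HasGrad at h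
  rw [hasFDerivWithinAt_univ] at h
  constructor
  · rw [SmoothAt.vfT_eq h.differentiableAt, h.fderiv]; simp
  · rw [SmoothAt.vfY_eq h.differentiableAt, h.fderiv]; simp

theorem two_sub_metricD_ge {M r : ℝ} (hM : 0 < M) (hr : M ≤ r) : 1 ≤ 2 - metricD M r := by
  linarith [metricD_le_one hM hr]

theorem one_le_sqrt_two_sub {M r : ℝ} (hM : 0 < M) (hr : M ≤ r) : 1 ≤ √(2 - metricD M r) :=
  Real.one_le_sqrt.2 (two_sub_metricD_ge hM hr)

section Smooth

variable {M : ℝ} {ψ : ℝ → ℝ → ℝ} {p : ℝ × ℝ}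

theorem contDiffAt_metricD_snd (hM : 0 < M) (hp : M ≤ p.2) :
    ContDiffAt ℝ ∞ (fun q : ℝ × ℝ => metricD M q.2) p :=
  (contDiffAt_metricD (hM.trans_le hp).ne').comp p contDiffAt_snd

theorem contDiffAt_sqrt_snd (hM : 0 < M) (hp : M ≤ p.2) :
    ContDiffAt ℝ ∞ (fun q : ℝ × ℝ => √(2 - metricD M q.2)) p :=
  (contDiffAt_const.sub (contDiffAt_metricD_snd hM hp)).sqrt
    (ne_of_gt (zero_lt_one.trans_le (two_sub_metricD_ge hM hp)))

theorem SmoothAt.normalDeriv (h : SmoothAt ψ p) (hM : 0 < M) (hp : M ≤ p.2) :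
    SmoothAt (normalDeriv M ψ) p :=
  ContDiffAt.div (h.vfT.sub ((contDiffAt_const.sub (contDiffAt_metricD_snd hM hp)).mul h.vfY))
    (contDiffAt_sqrt_snd hM hp) (by linarith [one_le_sqrt_two_sub hM hp])

theorem SmoothAt.tangentDeriv (h : SmoothAt ψ p) (hM : 0 < M) (hp : M ≤ p.2) :
    SmoothAt (tangentDeriv M ψ) p :=
  ContDiffAt.div (h.vfT.add h.vfY)
    (contDiffAt_sqrt_snd hM hp) (by linarith [one_le_sqrt_two_sub hM hp])

/-- The difference of the tangential and the normal derivative of `nψ`. -/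
theorem tangentDeriv_sub_normalDeriv (h : SmoothAt ψ p) (hM : 0 < M) (hp : M ≤ p.2) :
    tangentDeriv M (normalDeriv M ψ) p.1 p.2 - normalDeriv M (normalDeriv M ψ) p.1 p.2
      = vfT (vfY ψ) p.1 p.2 + deriv (metricD M) p.2 * vfY ψ p.1 p.2
        - (1 - metricD M p.2) * vfY (vfY ψ) p.1 p.2
        + deriv (metricD M) p.2 * (vfT ψ p.1 p.2 - (1 - metricD M p.2) * vfY ψ p.1 p.2)
          / (2 * (2 - metricD M p.2)) := by
  have hσ := one_le_sqrt_two_sub hM hp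
  have hσ0 : 0 < √(2 - metricD M p.2) := by linarith
  have hσ2 : √(2 - metricD M p.2) ^ 2 = 2 - metricD M p.2 :=
    Real.sq_sqrt (by linarith [two_sub_metricD_ge hM hp])
  have hD := hasDerivAt_metricD_deriv (M := M) (hM.trans_le hp).ne'
  have hs : HasDerivAt (fun r => (√(2 - metricD M r))⁻¹)
      (deriv (metricD M) p.2 / (2 * √(2 - metricD M p.2) ^ 3)) p.2 := by
    have := ((hD.const_sub 2).sqrt (by linarith [two_sub_metricD_ge hM hp])).inv hσ0.ne'
    refine this.congr_deriv ?_
    field_simp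
  have hg := ((h.vfT.hasGrad (K := univ)).sub (((HasGrad.radial (hD.const_sub 1))).mul
    h.vfY.hasGrad)).mul (HasGrad.radial hs)
  have e := (HasGrad.vfT_vfY_eq (ψ := ExtremalRN.normalDeriv M ψ) (by
    simpa only [ExtremalRN.normalDeriv, div_eq_mul_inv] using hg)).2
  -- As vector fields, tangent minus normal is `√(2 - D) Y`.
  have e1 : ExtremalRN.tangentDeriv M (ExtremalRN.normalDeriv M ψ) p.1 p.2
      - ExtremalRN.normalDeriv M (ExtremalRN.normalDeriv M ψ) p.1 p.2
      = √(2 - metricD M p.2) * ExtremalRN.vfY (ExtremalRN.normalDeriv M ψ) p.1 p.2 := by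
    unfold ExtremalRN.tangentDeriv
    conv_lhs => rw [ExtremalRN.normalDeriv]
    rw [← sub_div, div_eq_iff hσ0.ne']
    have := hσ2
    linear_combination (-ExtremalRN.vfY (ExtremalRN.normalDeriv M ψ) p.1 p.2) * this
  rw [e1, e, h.vfT_vfY, show 2 * (2 - metricD M p.2) = 2 * √(2 - metricD M p.2) ^ 2 by rw [hσ2]]
  field_simp
  ring

theorem SmoothAt.hasDerivAt_diag {r : ℝ} (h : SmoothAt ψ (r, r)) :
    HasDerivAt (fun r => ψ r r) (ExtremalRN.vfT ψ r r + ExtremalRN.vfY ψ r r) r := by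
  have := (h.hasGrad (K := univ)).along (hasDerivWithinAt_id r univ) (hasDerivWithinAt_id r univ)
    rfl (fun _ _ => mem_univ _)
  rw [hasDerivWithinAt_univ] at this
  simpa using this

theorem SmoothAt.continuousAt_diag {r : ℝ} (h : SmoothAt ψ (r, r)) :
    ContinuousAt (fun r => ψ r r) r := h.hasDerivAt_diag.continuousAt

end Smooth

/-! ### Bounds on the initial data -/

theorem exists_primitive_Icc {ρ : ℝ → ℝ} {x y : ℝ} (hxy : x ≤ y) (hρ : ContinuousOn ρ (Icc x y)) :
    ∃ P : ℝ → ℝ, (∀ t ∈ Icc x y, HasDerivWithinAt P (ρ t) (Icc x y) t) ∧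
      P y - P x = ∫ t in x..y, ρ t := by
  have hc : Continuous (IccExtend hxy ((Icc x y).domRestrict ρ)) :=
    (continuousOn_iff_continuous_domRestrict.1 hρ).Icc_extend'
  refine ⟨fun s => ∫ t in x..s, IccExtend hxy ((Icc x y).domRestrict ρ) t, fun t ht => ?_, ?_⟩
  · have := (intervalIntegral.integral_hasDerivAt_right (hc.intervalIntegrable x t)
      (hc.stronglyMeasurableAtFilter _ _) hc.continuousAt).hasDerivWithinAt (s := Icc x y)
    rwa [IccExtend_of_mem _ _ ht] at this
  · simp only [intervalIntegral.integral_same, sub_zero]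
    refine intervalIntegral.integral_congr fun t ht => ?_
    rw [uIcc_of_le hxy] at ht
    exact IccExtend_of_mem _ _ ht

/-- Integration inwards from `y`, where `f` vanishes. Since `∫ ρ ≤ k²`, the term `ρ/k` contributes
at most `k`: a Cauchy-Schwarz estimate in linear form. -/
theorem abs_le_of_abs_deriv_le {f f' ρ : ℝ → ℝ} {x y k c : ℝ} (hxy : x ≤ y) (hk : 0 < k)
    (hc : 0 ≤ c) (hρ : ContinuousOn ρ (Icc x y)) (hρ0 : ∀ t ∈ Icc x y, 0 ≤ ρ t)
    (hρk : ∫ t in x..y, ρ t ≤ k ^ 2) (hf : ∀ t ∈ Icc x y, HasDerivWithinAt f (f' t) (Icc x y) t)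
    (hfy : f y = 0) (hf' : ∀ t ∈ Icc x y, |f' t| ≤ c * (ρ t / k + k)) {r : ℝ} (hr : r ∈ Icc x y) :
    |f r| ≤ c * (1 + (y - x)) * k := by
  obtain ⟨P, hP, hPint⟩ := exists_primitive_Icc hxy hρ
  have hsub : Icc r y ⊆ Icc x y := Icc_subset_Icc_left hr.1
  have h1 := abs_sub_le_sub_of_abs_deriv_le hr.2 (fun t ht => (hf t (hsub ht)).mono hsub)
    (g := fun t => c * (P t / k + t * k)) (g' := fun t => c * (ρ t / k + 1 * k))
    (fun t ht => ((((hP t (hsub ht)).mono hsub).div_const k).add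
      ((hasDerivWithinAt_id t (Icc r y)).mul_const k)).const_mul c)
    (fun t ht => by simpa using hf' t (hsub ht))
  have h2 := le_of_hasDerivWithinAt_nonneg hr.1
    (fun t ht => (hP t ⟨ht.1, ht.2.trans hr.2⟩).mono (Icc_subset_Icc_right hr.2))
    (fun t ht => hρ0 t ⟨ht.1, ht.2.trans hr.2⟩)
  rw [hfy, zero_sub, abs_neg] at h1
  refine h1.trans ?_
  have h3 : (P y - P r) / k ≤ k := by
    rw [div_le_iff₀ hk]
    nlinarith
  have h4 : c * (P y / k + y * k) - c * (P r / k + r * k)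
      = c * ((P y - P r) / k + (y - r) * k) := by ring
  rw [h4, mul_assoc]
  refine mul_le_mul_of_nonneg_left ?_ hc
  nlinarith [hr.1]

/-- The volume weight `4π r² √(2 - D)` is at least `M²`. -/
theorem integral_le_of_intS_le {M R₀ e : ℝ} (hM : 0 < M) (hR₀ : M ≤ R₀) (he : 0 ≤ e)
    {f : ℝ → ℝ → ℝ} (hf0 : ∀ v r, 0 ≤ f v r) (hf : ContinuousOn (fun r => f r r) (Icc M R₀))
    (h : intS M R₀ 0 f ≤ ENNReal.ofReal e) : ∫ r in M..R₀, f r r ≤ e / M ^ 2 := by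
  rw [le_div_iff₀' (by positivity), intervalIntegral.integral_of_le hR₀,
    ← integral_Icc_eq_integral_Ioc, ← integral_const_mul, ← ENNReal.ofReal_le_ofReal_iff he]
  have hint : IntegrableOn (fun r => M ^ 2 * f r r) (Icc M R₀) :=
    (continuousOn_const.mul hf).integrableOn_Icc
  rw [ofReal_integral_eq_lintegral_ofReal hint
    (Eventually.of_forall fun r => mul_nonneg (sq_nonneg _) (hf0 _ _))]
  refine le_trans (setLIntegral_mono' measurableSet_Icc fun r hr => ?_) h
  refine ENNReal.ofReal_le_ofReal ?_
  rw [zero_add]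
  refine mul_le_mul_of_nonneg_right ?_ (hf0 _ _)
  have h1 := one_le_sqrt_two_sub hM hr.1
  have h2 : M ^ 2 ≤ r ^ 2 := by
    have := hr.1
    gcongr
  have h3 : (1 : ℝ) ≤ 4 * Real.pi := by linarith [Real.pi_gt_three]
  calc M ^ 2 ≤ r ^ 2 := h2
    _ ≤ 4 * Real.pi * r ^ 2 := le_mul_of_one_le_left (sq_nonneg r) h3
    _ ≤ 4 * Real.pi * r ^ 2 * √(2 - metricD M r) := le_mul_of_one_le_right (by positivity) h1

theorem eq_zero_of_forall_gt {f : ℝ → ℝ} {x : ℝ} (hf : ContinuousAt f x) (h : ∀ y, x < y → f y = 0) :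
    f x = 0 := by
  have h1 : Tendsto f (𝓝[>] x) (𝓝 (f x)) := hf.tendsto.mono_left nhdsWithin_le_nhds
  have h2 : Tendsto f (𝓝[>] x) (𝓝 0) := by
    refine tendsto_const_nhds.congr' ?_
    filter_upwards [self_mem_nhdsWithin] with y hy using (h y hy).symm
  exact tendsto_nhds_unique h1 h2

/-- The density controlled by the initial energy on `S_0`. -/
noncomputable def dataDensity (M : ℝ) (ψ : ℝ → ℝ → ℝ) (r : ℝ) : ℝ :=
  vfY ψ r r ^ 2 + vfT ψ r r ^ 2 + normalDeriv M (normalDeriv M ψ) r r ^ 2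
    + tangentDeriv M (normalDeriv M ψ) r r ^ 2

theorem abs_le_div_add {x y k : ℝ} (hk : 0 < k) (h : x ^ 2 ≤ y) : |x| ≤ (y / k + k) / 2 := by
  have h1 : x ^ 2 / k ≤ y / k := by gcongr
  have h2 : x ^ 2 / k + k - 2 * |x| = (|x| - k) ^ 2 / k := by
    rw [← sq_abs x]; field_simp; ring
  have h3 : 0 ≤ (|x| - k) ^ 2 / k := by positivity
  linarith

/-- The energy contains no second derivatives other than those of `nψ`. From these `√(2 - D) Y(nψ)`
gives `TYψ - (1 - D) YYψ` up to first-order terms, and the wave equation gives `2 TYψ + D YYψ`; the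
difference is the derivative of `Yψ` along `{v = r}`. -/
theorem abs_vfT_add_vfY_vfY_le {M b k r : ℝ} (hM : 0 < M) (hr : M ≤ r) (hb : 0 ≤ b) (hk : 0 < k)
    (hk1 : k ≤ 1) {A : ℝ → ℝ} (hA : ∀ x, |A x| ≤ b) {ψ : ℝ → ℝ → ℝ} (h : SmoothAt ψ (r, r))
    (heq : box M ψ r r = nonlin M A ψ r r) :
    |vfT (vfY ψ) r r + vfY (vfY ψ) r r|
      ≤ (2 * b + 2 * (3 / M + 1)) * (dataDensity M ψ r / k + k) := by
  have hr0 := hM.trans_le hr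
  have hD0 := metricD_nonneg M r
  have hD1 := metricD_le_one hM hr
  have hD' := deriv_metricD_nonneg hM hr
  have hD'' : deriv (metricD M) r ≤ 2 / M := by
    refine (deriv_metricD_le hM hr).trans ?_
    rw [div_le_div_iff₀ (by positivity) hM]
    nlinarith
  have hX := tangentDeriv_sub_normalDeriv h hM hr
  simp only at hX
  have hT : |vfT ψ r r| ≤ (dataDensity M ψ r / k + k) / 2 := abs_le_div_add hk (by
    unfold dataDensity; nlinarith)
  have hY : |vfY ψ r r| ≤ (dataDensity M ψ r / k + k) / 2 := abs_le_div_add hk (by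
    unfold dataDensity; nlinarith)
  have hXX : |tangentDeriv M (normalDeriv M ψ) r r| ≤ (dataDensity M ψ r / k + k) / 2 :=
    abs_le_div_add hk (by unfold dataDensity; nlinarith)
  have hNN : |normalDeriv M (normalDeriv M ψ) r r| ≤ (dataDensity M ψ r / k + k) / 2 :=
    abs_le_div_add hk (by unfold dataDensity; nlinarith)
  have hρ0 : 0 ≤ dataDensity M ψ r := by unfold dataDensity; positivity
  have hF : |nonlin M A ψ r r| ≤ 2 * b * (dataDensity M ψ r / k + k) := by
    have h1 : |metricD M r * vfY ψ r r ^ 2 + 2 * vfT ψ r r * vfY ψ r r|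
        ≤ 2 * dataDensity M ψ r := by
      have i1 : vfY ψ r r ^ 2 + vfT ψ r r ^ 2 ≤ dataDensity M ψ r := by
        unfold dataDensity
        nlinarith [sq_nonneg (normalDeriv M (normalDeriv M ψ) r r),
          sq_nonneg (tangentDeriv M (normalDeriv M ψ) r r)]
      have i2 : metricD M r * vfY ψ r r ^ 2 ≤ vfY ψ r r ^ 2 :=
        mul_le_of_le_one_left (sq_nonneg _) hD1
      have i3 : 0 ≤ metricD M r * vfY ψ r r ^ 2 := by positivity
      rw [abs_le]
      constructor <;> nlinarith [sq_nonneg (vfT ψ r r + vfY ψ r r),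
        sq_nonneg (vfT ψ r r - vfY ψ r r)]
    -- The nonlinearity is quadratic, hence bounded by the density itself; `k ≤ 1` fits it into the
    -- linear scheme.
    have h2 : dataDensity M ψ r ≤ dataDensity M ψ r / k := le_div_self hρ0 hk hk1
    unfold nonlin
    rw [abs_mul]
    calc _ ≤ b * (2 * dataDensity M ψ r) := mul_le_mul (hA _) h1 (abs_nonneg _) hb
      _ = 2 * b * dataDensity M ψ r := by ring
      _ ≤ _ := by gcongr; linarith
  set B := dataDensity M ψ r / k + k with hB
  have hB0 : 0 < B := by positivity
  have e : vfT (vfY ψ) r r + vfY (vfY ψ) r r = nonlin M A ψ r r - 2 / r * vfT ψ r r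
      - 2 / r * (metricD M r * vfY ψ r r) - (tangentDeriv M (normalDeriv M ψ) r r
        - normalDeriv M (normalDeriv M ψ) r r)
      + deriv (metricD M) r * ((vfT ψ r r - (1 - metricD M r) * vfY ψ r r)
          / (2 * (2 - metricD M r))) := by
    rw [hX, ← heq]
    unfold box
    ring
  have h2r : 2 / r ≤ 2 / M := by gcongr
  have i1 : |2 / r * vfT ψ r r| ≤ 2 / M * (B / 2) := by
    rw [abs_mul, abs_of_pos (by positivity)]
    gcongr
  have i2 : |2 / r * (metricD M r * vfY ψ r r)| ≤ 2 / M * (B / 2) := by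
    rw [abs_mul, abs_of_pos (by positivity), abs_mul, abs_of_nonneg hD0]
    gcongr
    exact (mul_le_of_le_one_left (abs_nonneg _) hD1).trans hY
  have i3 : |deriv (metricD M) r * ((vfT ψ r r - (1 - metricD M r) * vfY ψ r r)
          / (2 * (2 - metricD M r)))| ≤ 2 / M * B := by
    rw [abs_mul, abs_of_nonneg hD', abs_div, abs_of_pos (by linarith : 0 < 2 * (2 - metricD M r))]
    have j1 : |vfT ψ r r - (1 - metricD M r) * vfY ψ r r| ≤ B := by
      refine (abs_sub _ _).trans ?_
      rw [abs_mul, abs_of_nonneg (by linarith : 0 ≤ 1 - metricD M r)]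
      have : (1 - metricD M r) * |vfY ψ r r| ≤ |vfY ψ r r| :=
        mul_le_of_le_one_left (abs_nonneg _) (by linarith)
      linarith
    exact mul_le_mul hD'' ((div_le_self (abs_nonneg _) (by linarith)).trans j1)
      (div_nonneg (abs_nonneg _) (by linarith)) (by positivity)
  rw [e]
  rw [abs_le] at hF i1 i2 i3 hXX hNN ⊢
  have e3 : (2 * b + 2 * (3 / M + 1)) * B
      = 2 * b * B + (2 / M * (B / 2) + 2 / M * (B / 2) + 2 / M * B + B) + (2 / M * B + B) := by
    ring
  have : 0 < 2 / M * B + B := by positivity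
  rw [e3]
  constructor <;> linarith

/-- One-dimensional Sobolev bounds for `ψ`, `nψ` and `Yψ`, all of which vanish at `R₀`; `Tψ` is a
combination of the last two. -/
theorem exists_data_bound {M R₀ b : ℝ} (hM : 0 < M) (hR₀ : M < R₀) (hb : 0 ≤ b) :
    ∃ L : ℝ, 0 < L ∧ ∀ (k : ℝ) (A : ℝ → ℝ) (ψ : ℝ → ℝ → ℝ), 0 < k → k ≤ 1 → (∀ x, |A x| ≤ b) →
      (∀ r, M ≤ r → SmoothAt ψ (r, r)) → (∀ r, M ≤ r → box M ψ r r = nonlin M A ψ r r) →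
      (∀ r, R₀ < r → ψ r r = 0 ∧ normalDeriv M ψ r r = 0) →
      ∫ r in M..R₀, dataDensity M ψ r ≤ k ^ 2 → DataBound M R₀ (L * k) ψ := by
  set c := 2 * b + 2 * (3 / M + 1) with hc
  have hc0 : 2 ≤ c := by
    have : 0 ≤ 3 / M := by positivity
    linarith
  set l := c * (1 + (R₀ - M)) with hl
  have hl0 : 0 < l := by
    have := sub_pos.2 hR₀
    positivity
  refine ⟨3 * l, by positivity, ?_⟩
  intro k A ψ hk hk1 hA hψ heq hsupp hint
  have hn : ∀ r, M ≤ r → SmoothAt (normalDeriv M ψ) (r, r) := fun r hr => (hψ r hr).normalDeriv hM hr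
  have hcont : ∀ f : ℝ → ℝ → ℝ, (∀ r, M ≤ r → SmoothAt f (r, r)) →
      ContinuousOn (fun r => f r r) (Ici M) :=
    fun f hf r hr => (hf r hr).continuousAt_diag.continuousWithinAt
  have hzeroTY : ∀ r, R₀ < r → vfT ψ r r = 0 ∧ vfY ψ r r = 0 := by
    intro r hr
    have hMr := (hR₀.trans hr).le
    have hd := (hψ r hMr).hasDerivAt_diag
    have hd0 : HasDerivAt (fun r => ψ r r) 0 r := by
      refine (hasDerivAt_const r (0 : ℝ)).congr_of_eventuallyEq ?_
      filter_upwards [lt_mem_nhds hr] with s hs using (hsupp s hs).1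
    have e1 := hd.unique hd0
    have e2 := (hsupp r hr).2
    have hσ := one_le_sqrt_two_sub hM hMr
    unfold normalDeriv at e2
    rw [div_eq_zero_iff] at e2
    have e3 := e2.resolve_right (by linarith)
    -- Outside the support both the tangential derivative `T + Y` and `T - (1 - D) Y` vanish on `ψ`.
    have e4 : (2 - metricD M r) * vfY ψ r r = 0 := by linarith
    have e5 : vfY ψ r r = 0 := by
      rcases mul_eq_zero.1 e4 with h | h
      · linarith [two_sub_metricD_ge hM hMr]
      · exact h
    exact ⟨by rw [e5] at e1; linarith, e5⟩
  have hρc : ContinuousOn (dataDensity M ψ) (Icc M R₀) := by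
    refine ContinuousOn.mono ?_ Icc_subset_Ici_self
    unfold dataDensity
    exact ((((hcont _ fun r hr => (hψ r hr).vfY).pow 2).add
      ((hcont _ fun r hr => (hψ r hr).vfT).pow 2)).add
      ((hcont _ fun r hr => (hn r hr).normalDeriv hM hr).pow 2)).add
      ((hcont _ fun r hr => (hn r hr).tangentDeriv hM hr).pow 2)
  have hρ0 : ∀ t ∈ Icc M R₀, 0 ≤ dataDensity M ψ t := fun t _ => by
    unfold dataDensity; positivity
  have hB0 : ∀ t ∈ Icc M R₀, 0 ≤ dataDensity M ψ t / k + k := fun t ht => by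
    have := hρ0 t ht
    positivity
  have key : ∀ f : ℝ → ℝ → ℝ, (∀ r, M ≤ r → SmoothAt f (r, r)) → (∀ r, R₀ < r → f r r = 0) →
      (∀ r ∈ Icc M R₀, |vfT f r r + vfY f r r| ≤ c * (dataDensity M ψ r / k + k)) →
      ∀ r, M ≤ r → r ≤ R₀ → |f r r| ≤ l * k := fun f hf hf0 hf' r h1 h2 =>
    abs_le_of_abs_deriv_le hR₀.le hk (by linarith) hρc hρ0 hint
      (fun t ht => (hf t ht.1).hasDerivAt_diag.hasDerivWithinAt)
      (eq_zero_of_forall_gt (f := fun r => f r r) (hf R₀ hR₀.le).continuousAt_diag hf0) hf' ⟨h1, h2⟩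
  have b1 := key ψ hψ (fun r hr => (hsupp r hr).1) (by
    intro r hr
    have hT : |vfT ψ r r| ≤ (dataDensity M ψ r / k + k) / 2 := abs_le_div_add hk (by
      unfold dataDensity; nlinarith)
    have hY : |vfY ψ r r| ≤ (dataDensity M ψ r / k + k) / 2 := abs_le_div_add hk (by
      unfold dataDensity; nlinarith)
    have := hB0 r hr
    have := abs_add_le (vfT ψ r r) (vfY ψ r r)
    nlinarith)
  have b2 := key (normalDeriv M ψ) hn (fun r hr => (hsupp r hr).2) (by
    intro r hr
    have hX : |tangentDeriv M (normalDeriv M ψ) r r| ≤ (dataDensity M ψ r / k + k) / 2 :=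
      abs_le_div_add hk (by unfold dataDensity; nlinarith)
    have hσ := one_le_sqrt_two_sub hM hr.1
    have hσ2 : √(2 - metricD M r) ≤ 2 := by
      rw [Real.sqrt_le_left two_pos.le]
      linarith [metricD_nonneg M r]
    have e : vfT (normalDeriv M ψ) r r + vfY (normalDeriv M ψ) r r
        = √(2 - metricD M r) * tangentDeriv M (normalDeriv M ψ) r r := by
      unfold tangentDeriv
      field_simp
    rw [e, abs_mul, abs_of_pos (by linarith)]
    have := hB0 r hr
    have := abs_nonneg (tangentDeriv M (normalDeriv M ψ) r r)
    nlinarith)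
  have b3 := key (vfY ψ) (fun r hr => (hψ r hr).vfY) (fun r hr => (hzeroTY r hr).2)
    (fun r hr => abs_vfT_add_vfY_vfY_le hM hr.1 hb hk hk1 hA (hψ r hr.1) (heq r hr.1))
  have hlk : 0 < l * k := by positivity
  refine ⟨hcont _ hψ, hcont _ fun r hr => (hψ r hr).vfY, fun r h1 h2 => ?_, fun r h1 h2 => ?_,
    fun r h1 h2 => ?_, fun r hr => (hsupp r hr).1, fun r hr => (hzeroTY r hr).2,
    fun r hr => (hzeroTY r hr).1⟩
  · linarith [b1 r h1 h2]
  · linarith [b3 r h1 h2]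
  · have hσ := one_le_sqrt_two_sub hM h1
    have hσ2 : √(2 - metricD M r) ≤ 2 := by
      rw [Real.sqrt_le_left two_pos.le]
      linarith [metricD_nonneg M r]
    have e : vfT ψ r r = √(2 - metricD M r) * normalDeriv M ψ r r
        + (1 - metricD M r) * vfY ψ r r := by
      unfold normalDeriv
      field_simp
      ring
    rw [e]
    refine (abs_add_le _ _).trans ?_
    rw [abs_mul, abs_mul, abs_of_pos (by linarith : 0 < √(2 - metricD M r)),
      abs_of_nonneg (by linarith [metricD_le_one hM h1] : 0 ≤ 1 - metricD M r)]
    have i1 := b2 r h1 h2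
    have i2 := b3 r h1 h2
    have i3 := abs_nonneg (normalDeriv M ψ r r)
    have i4 := abs_nonneg (vfY ψ r r)
    have := metricD_nonneg M r
    nlinarith

/-! ### Linearisation of the null form -/

/-- The derivative of `linearizer A`, which solves `y' = -A y`, `y 0 = 1`. -/
noncomputable def linearizerDeriv (A : ℝ → ℝ) (x : ℝ) : ℝ := Real.exp (-∫ s in (0 : ℝ)..x, A s)

/-- The change of the unknown that turns `□ψ = A(ψ) g(∂ψ, ∂ψ)` into the linear wave equation. -/
noncomputable def linearizer (A : ℝ → ℝ) (x : ℝ) : ℝ := ∫ s in (0 : ℝ)..x, linearizerDeriv A s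

section Linearizer

variable {A : ℝ → ℝ} {b : ℝ}

theorem hasDerivAt_linearizerDeriv (hA : Continuous A) (x : ℝ) :
    HasDerivAt (linearizerDeriv A) (-A x * linearizerDeriv A x) x := by
  have := (intervalIntegral.integral_hasDerivAt_right (hA.intervalIntegrable 0 x)
    (hA.stronglyMeasurableAtFilter _ _) hA.continuousAt).neg.exp
  refine this.congr_deriv ?_
  rw [mul_comm]
  rfl

theorem continuous_linearizerDeriv (hA : Continuous A) : Continuous (linearizerDeriv A) :=
  continuous_iff_continuousAt.2 fun x => (hasDerivAt_linearizerDeriv hA x).continuousAt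

theorem hasDerivAt_linearizer (hA : Continuous A) (x : ℝ) :
    HasDerivAt (linearizer A) (linearizerDeriv A x) x :=
  have hc := continuous_linearizerDeriv hA
  intervalIntegral.integral_hasDerivAt_right (hc.intervalIntegrable 0 x)
    (hc.stronglyMeasurableAtFilter _ _) hc.continuousAt

theorem contDiff_linearizer (hA : ContDiff ℝ ∞ A) : ContDiff ℝ ∞ (linearizer A) := by
  have hAc := hA.continuous
  have h1 : ContDiff ℝ ∞ (fun x => ∫ s in (0 : ℝ)..x, A s) := by
    have hd : ∀ x, HasDerivAt (fun x => ∫ s in (0 : ℝ)..x, A s) (A x) x := fun x =>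
      intervalIntegral.integral_hasDerivAt_right (hAc.intervalIntegrable 0 x)
        (hAc.stronglyMeasurableAtFilter _ _) hAc.continuousAt
    rw [contDiff_infty_iff_deriv]
    refine ⟨fun x => (hd x).differentiableAt, ?_⟩
    rwa [show deriv (fun x => ∫ s in (0 : ℝ)..x, A s) = A from funext fun x => (hd x).deriv]
  have h2 : ContDiff ℝ ∞ (linearizerDeriv A) := h1.neg.exp
  rw [contDiff_infty_iff_deriv]
  refine ⟨fun x => (hasDerivAt_linearizer hAc x).differentiableAt, ?_⟩
  rwa [show deriv (linearizer A) = linearizerDeriv A from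
    funext fun x => (hasDerivAt_linearizer hAc x).deriv]

theorem linearizer_zero : linearizer A 0 = 0 := by simp [linearizer]

theorem linearizerDeriv_pos (x : ℝ) : 0 < linearizerDeriv A x := Real.exp_pos _

theorem linearizerDeriv_bounds (hb : ∀ x, |A x| ≤ b) {x : ℝ} (hx : |x| ≤ 1) :
    Real.exp (-b) ≤ linearizerDeriv A x ∧ linearizerDeriv A x ≤ Real.exp b := by
  have hb0 : 0 ≤ b := (abs_nonneg _).trans (hb 0)
  have h1 : |∫ s in (0 : ℝ)..x, A s| ≤ b := by
    have := intervalIntegral.norm_integral_le_of_norm_le_const (a := 0) (b := x) (C := b) (f := A)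
      (fun s _ => hb s)
    rw [Real.norm_eq_abs, sub_zero] at this
    exact this.trans (mul_le_of_le_one_right hb0 hx)
  rw [abs_le] at h1
  exact ⟨Real.exp_le_exp.2 (by linarith), Real.exp_le_exp.2 (by linarith)⟩

theorem abs_linearizer_le (hA : Continuous A) (hb : ∀ x, |A x| ≤ b) {x : ℝ} (hx : |x| ≤ 1) :
    |linearizer A x| ≤ Real.exp b * |x| := by
  have hc := continuous_linearizerDeriv hA
  have := intervalIntegral.norm_integral_le_of_norm_le_const (a := 0) (b := x) (C := Real.exp b)
      (f := linearizerDeriv A) (fun s hs => by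
        rw [Real.norm_eq_abs, abs_of_pos (linearizerDeriv_pos s)]
        refine (linearizerDeriv_bounds hb ?_).2
        rw [abs_le] at hx ⊢
        rcases le_total 0 x with h | h
        · rw [uIoc_of_le h] at hs
          exact ⟨by linarith [hs.1], by linarith [hs.2]⟩
        · rw [uIoc_of_ge h] at hs
          exact ⟨by linarith [hs.1], by linarith [hs.2]⟩)
  rwa [sub_zero, Real.norm_eq_abs] at this

theorem strictMono_linearizer (hA : Continuous A) : StrictMono (linearizer A) :=
  strictMono_of_hasDerivAt_pos (fun x => hasDerivAt_linearizer hA x) linearizerDeriv_pos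

theorem abs_le_of_linearizer (hA : Continuous A) (hb : ∀ x, |A x| ≤ b) {x : ℝ} (hx : |x| ≤ 1) :
    |x| ≤ Real.exp b * |linearizer A x| := by
  -- On `[-1, 1]` the slope of the linearizer is at least `exp (-b)`.
  have hmono : ∀ s t, |s| ≤ 1 → |t| ≤ 1 → s ≤ t →
      linearizer A s - Real.exp (-b) * s ≤ linearizer A t - Real.exp (-b) * t := by
    intro s t hs ht hst
    rw [abs_le] at hs ht
    refine le_of_hasDerivWithinAt_nonneg (f := fun s => linearizer A s - Real.exp (-b) * s)
      (f' := fun s => linearizerDeriv A s - Real.exp (-b) * 1) hst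
      (fun y _ => ((hasDerivAt_linearizer hA y).sub
        ((hasDerivAt_id y).const_mul _)).hasDerivWithinAt) (fun y hy => ?_)
    have := (linearizerDeriv_bounds hb (abs_le.2 ⟨hs.1.trans hy.1, hy.2.trans ht.2⟩)).1
    linarith
  have he : Real.exp b * Real.exp (-b) = 1 := by rw [← Real.exp_add]; simp
  have hpos := Real.exp_pos b
  have h0 : |(0 : ℝ)| ≤ 1 := by simp
  rcases le_total 0 x with h | h
  · have h1 := hmono 0 x h0 hx h
    rw [linearizer_zero] at h1
    rw [abs_of_nonneg h]
    have h2 : Real.exp (-b) * x ≤ |linearizer A x| := by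
      linarith [le_abs_self (linearizer A x)]
    calc x = Real.exp b * (Real.exp (-b) * x) := by rw [← mul_assoc, he, one_mul]
      _ ≤ _ := by gcongr
  · have h1 := hmono x 0 hx h0 h
    rw [linearizer_zero] at h1
    rw [abs_of_nonpos h]
    have h2 : Real.exp (-b) * (-x) ≤ |linearizer A x| := by
      linarith [neg_le_abs (linearizer A x)]
    calc -x = Real.exp b * (Real.exp (-b) * (-x)) := by rw [← mul_assoc, he, one_mul]
      _ ≤ _ := by gcongr

/-- By strict monotonicity a value below those at `±1` forces `|x| ≤ 1`. Smallness of `φ` thus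
yields smallness of `ψ` pointwise, without a continuity argument in time. -/
theorem abs_le_one_of_linearizer (hA : Continuous A) (hb : ∀ x, |A x| ≤ b) {x : ℝ}
    (hx : Real.exp b * |linearizer A x| < 1) : |x| ≤ 1 := by
  by_contra! h
  have hm := strictMono_linearizer hA
  have hpos := Real.exp_pos b
  rcases lt_abs.1 h with h | h
  · have h1 := abs_le_of_linearizer hA hb (x := 1) (by simp)
    have h2 : 0 < linearizer A 1 := by
      rw [← linearizer_zero (A := A)]; exact hm one_pos
    have h3 := hm h
    rw [abs_of_pos h2, abs_one] at h1
    rw [abs_of_pos (h2.trans h3)] at hx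
    nlinarith
  · have h1 := abs_le_of_linearizer hA hb (x := -1) (by simp)
    have h2 : linearizer A (-1) < 0 := by
      rw [← linearizer_zero (A := A)]; exact hm (by norm_num)
    have h3 := hm (show x < -1 by linarith)
    rw [abs_of_neg h2, abs_neg, abs_one] at h1
    rw [abs_of_neg (h3.trans h2)] at hx
    nlinarith

end Linearizer

section Compose

variable {M : ℝ} {A : ℝ → ℝ} {ψ : ℝ → ℝ → ℝ} {p : ℝ × ℝ}

theorem SmoothAt.linearizer (h : SmoothAt ψ p) (hA : ContDiff ℝ ∞ A) :
    SmoothAt (fun v r => linearizer A (ψ v r)) p :=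
  (contDiff_linearizer hA).contDiffAt.comp p h

theorem vf_linearizer (h : SmoothAt ψ p) (hA : Continuous A) :
    vfT (fun v r => linearizer A (ψ v r)) p.1 p.2
        = linearizerDeriv A (ψ p.1 p.2) * vfT ψ p.1 p.2 ∧
      vfY (fun v r => linearizer A (ψ v r)) p.1 p.2
        = linearizerDeriv A (ψ p.1 p.2) * vfY ψ p.1 p.2 :=
  HasGrad.vfT_vfY_eq (ψ := fun v r => linearizer A (ψ v r))
    (HasGrad.comp (f := fun q => ψ q.1 q.2) (hasDerivAt_linearizer hA _) h.hasGrad)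

theorem vfY_vf_linearizer (h : SmoothAt ψ p) (hA : Continuous A) :
    vfT (vfY (fun v r => linearizer A (ψ v r))) p.1 p.2
        = linearizerDeriv A (ψ p.1 p.2) * (vfT (vfY ψ) p.1 p.2
          - A (ψ p.1 p.2) * vfT ψ p.1 p.2 * vfY ψ p.1 p.2) ∧
      vfY (vfY (fun v r => linearizer A (ψ v r))) p.1 p.2
        = linearizerDeriv A (ψ p.1 p.2) * (vfY (vfY ψ) p.1 p.2
          - A (ψ p.1 p.2) * vfY ψ p.1 p.2 ^ 2) := by
  have h1 := (HasGrad.comp (f := fun q => ψ q.1 q.2) (K := univ)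
    (hasDerivAt_linearizerDeriv hA (ψ p.1 p.2)) h.hasGrad).mul h.vfY.hasGrad
  have hev : (fun q : ℝ × ℝ => vfY (fun v r => linearizer A (ψ v r)) q.1 q.2) =ᶠ[𝓝 p]
      fun q => linearizerDeriv A (ψ q.1 q.2) * vfY ψ q.1 q.2 := by
    filter_upwards [h.eventually_differentiableAt] with q hq
    have hd : HasDerivAt (fun r => ψ q.1 r) (vfY ψ q.1 q.2) q.2 := by
      have : DifferentiableAt ℝ (fun r => ψ q.1 r) q.2 :=
        DifferentiableAt.comp q.2 (f := fun r => (q.1, r)) (g := fun q : ℝ × ℝ => ψ q.1 q.2) hq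
          (by fun_prop)
      exact this.hasDerivAt
    exact ((hasDerivAt_linearizer hA (ψ q.1 q.2)).comp q.2 hd).deriv
  have h2 := HasGrad.vfT_vfY_eq (ψ := vfY (fun v r => linearizer A (ψ v r))) (p := p)
    (HasFDerivWithinAt.congr_of_eventuallyEq h1 (by simpa using hev) hev.eq_of_nhds)
  refine ⟨h2.1.trans ?_, h2.2.trans ?_⟩ <;> ring

theorem box_linearizer (h : SmoothAt ψ p) (hA : Continuous A)
    (heq : box M ψ p.1 p.2 = nonlin M A ψ p.1 p.2) :
    box M (fun v r => linearizer A (ψ v r)) p.1 p.2 = 0 := by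
  unfold box nonlin at *
  rw [(vf_linearizer h hA).1, (vf_linearizer h hA).2, (vfY_vf_linearizer h hA).1,
    (vfY_vf_linearizer h hA).2]
  linear_combination linearizerDeriv A (ψ p.1 p.2) * heq

theorem DataBound.linearizer {R₀ k b : ℝ} (hR₀ : M < R₀) (hk1 : k ≤ 1) (h : DataBound M R₀ k ψ)
    (hψ : ∀ r, M ≤ r → SmoothAt ψ (r, r)) (hA : Continuous A) (hb : ∀ x, |A x| ≤ b) :
    DataBound M R₀ (Real.exp b * k) (fun v r => linearizer A (ψ v r)) := by
  have hg := fun r hr h2 => (linearizerDeriv_bounds hb ((h.boundφ r hr h2).trans hk1)).2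
  have hvf := fun r hr => vf_linearizer (hψ r hr) hA
  have hpos := Real.exp_pos b
  refine ⟨?_, ?_, fun r h1 h2 => ?_, fun r h1 h2 => ?_, fun r h1 h2 => ?_, fun r hr => ?_,
    fun r hr => ?_, fun r hr => ?_⟩
  · exact (continuous_iff_continuousAt.2 fun x =>
      (hasDerivAt_linearizer hA x).continuousAt).comp_continuousOn h.contφ
  · refine (((continuous_linearizerDeriv hA).comp_continuousOn h.contφ).mul h.contY).congr ?_
    exact fun r hr => (hvf r hr).2
  · refine (abs_linearizer_le hA hb ((h.boundφ r h1 h2).trans hk1)).trans ?_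
    gcongr
    exact h.boundφ r h1 h2
  · rw [(hvf r h1).2, abs_mul, abs_of_pos (linearizerDeriv_pos _)]
    gcongr
    · exact hg r h1 h2
    · exact h.boundY r h1 h2
  · rw [(hvf r h1).1, abs_mul, abs_of_pos (linearizerDeriv_pos _)]
    gcongr
    · exact hg r h1 h2
    · exact h.boundT r h1 h2
  · simp [h.zeroφ r hr, linearizer_zero]
  · simp [hvf r (hR₀.trans hr).le, h.zeroY r hr]
  · simp [hvf r (hR₀.trans hr).le, h.zeroT r hr]

end Compose

/-! ### Nonlinear bounds -/

theorem exists_nonlinear_bound {M R₀ b : ℝ} (hM : 0 < M) (hR₀ : 2 * M < R₀) (hb : 0 ≤ b) :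
    ∃ B κ : ℝ, 0 < B ∧ 0 < κ ∧ ∀ (k : ℝ) (A : ℝ → ℝ) (𝒯 : EReal) (ψ : ℝ → ℝ → ℝ), 0 < k → k < κ →
      ContDiff ℝ ∞ A → (∀ x, |A x| ≤ b) → 0 < 𝒯 → IsSolution M R₀ A 𝒯 ψ →
      ∫ r in M..R₀, dataDensity M ψ r ≤ k ^ 2 →
      ∀ τ : ℝ, 0 ≤ τ → (τ : EReal) < 𝒯 → ∀ p ∈ leafSigma M R₀ τ, M < p.2 →
        |vfY ψ p.1 p.2| ≤ B * k ∧ |p.2 * ψ p.1 p.2| ≤ B * k ∧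
          |p.2 ^ 2 * nullDv M ψ p.1 p.2| ≤ B * k := by
  have hMR : M < R₀ := by linarith
  obtain ⟨L₁, hL₁, hdata⟩ := exists_data_bound hM hMR hb
  obtain ⟨L₂, hL₂, hlin⟩ := exists_linear_bound hM hR₀
  have hpos := Real.exp_pos b
  set B := Real.exp b * (L₂ * (Real.exp b * L₁)) with hB
  have hB0 : 0 < B := by positivity
  -- One factor `exp b` in `B` comes from passing to `φ` on the data, the other from returning to
  -- `ψ`. The threshold ensures `k ≤ 1`, `L₁ k ≤ 1` and `B k < 1`.
  refine ⟨B, 1 / (1 + L₁ + B), hB0, by positivity, ?_⟩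
  intro k A 𝒯 ψ hk hkκ hA hAb h𝒯 hψ hint τ hτ hτ𝒯 p hp hpM
  rw [lt_div_iff₀ (by positivity)] at hkκ
  have hk1 : k ≤ 1 := by nlinarith [mul_pos hk hL₁, mul_pos hk hB0]
  have hLk : L₁ * k ≤ 1 := by nlinarith [mul_pos hk hL₁, mul_pos hk hB0]
  have hBk : B * k < 1 := by nlinarith [mul_pos hk hL₁, mul_pos hk hB0]
  have hAc := hA.continuous
  have hinit : ∀ r, M ≤ r → (r, r) ∈ region M R₀ 𝒯 := fun r hr =>
    initial_mem_region hM hMR h𝒯 hr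
  have hψs : ∀ r, M ≤ r → SmoothAt ψ (r, r) := fun r hr => hψ.smooth _ (hinit r hr)
  have hd := hdata k A ψ hk hk1 hAb hψs (fun r hr => hψ.equation _ (hinit r hr)) hψ.support hint
  have hdφ := hd.linearizer hMR hLk hψs hAc hAb
  have hsub := pastTriangle_subset_region hM hMR hτ𝒯 hp
  have hpr := (le_of_mem_leafSigma hM hMR hτ hp).2
  have hself := hsub (self_mem_pastTriangle hpM hpr)
  obtain ⟨c0, c1, c2, c3⟩ := hlin _ _ p (by positivity) hpM hpr
    (fun q hq => SmoothAt.linearizer (hψ.smooth q (hsub hq)) hA)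
    (fun q hq => box_linearizer (hψ.smooth q (hsub hq)) hAc (hψ.equation q (hsub hq))) hdφ
  have eB : B * k = Real.exp b * (L₂ * (Real.exp b * (L₁ * k))) := by rw [hB]; ring
  have hψ1 : |ψ p.1 p.2| ≤ 1 := by
    refine abs_le_one_of_linearizer hAc hAb (lt_of_le_of_lt ?_ hBk)
    rw [eB]
    gcongr
  have hg := (linearizerDeriv_bounds hAb hψ1).1
  have hvf := vf_linearizer (hψ.smooth p hself) hAc
  have hcancel : ∀ x, |linearizerDeriv A (ψ p.1 p.2) * x| ≤ L₂ * (Real.exp b * (L₁ * k)) →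
      |x| ≤ B * k := by
    intro x hx
    rw [abs_mul, abs_of_pos (linearizerDeriv_pos _)] at hx
    have he : Real.exp b * Real.exp (-b) = 1 := by rw [← Real.exp_add]; simp
    calc |x| = Real.exp b * (Real.exp (-b) * |x|) := by rw [← mul_assoc, he, one_mul]
      _ ≤ Real.exp b * (linearizerDeriv A (ψ p.1 p.2) * |x|) := by gcongr
      _ ≤ _ := by rw [eB]; gcongr
  refine ⟨hcancel _ ?_, ?_, hcancel _ ?_⟩
  · rwa [← hvf.2]
  · have hr0 := hM.trans hpM
    rw [abs_mul, abs_of_pos hr0] at c1 ⊢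
    calc _ ≤ p.2 * (Real.exp b * |linearizer A (ψ p.1 p.2)|) := by
          gcongr
          exact abs_le_of_linearizer hAc hAb hψ1
      _ = Real.exp b * (p.2 * |linearizer A (ψ p.1 p.2)|) := by ring
      _ ≤ _ := by rw [eB]; gcongr
  · convert c3 using 2
    unfold nullDv
    rw [hvf.1, hvf.2]
    ring

/-- Bounds off the horizon extend to the horizon by continuity. -/
theorem le_on_leafSigma_of_lt {M R₀ τ c : ℝ} (hM : 0 < M) (hR₀ : M < R₀) {𝒯 : EReal} (hτ : 0 ≤ τ)
    (hτ𝒯 : (τ : EReal) < 𝒯) {f : ℝ → ℝ → ℝ}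
    (hf : ∀ p ∈ region M R₀ 𝒯, ContinuousAt (fun q : ℝ × ℝ => f q.1 q.2) p)
    (h : ∀ p ∈ leafSigma M R₀ τ, M < p.2 → |f p.1 p.2| ≤ c) {p : ℝ × ℝ}
    (hp : p ∈ leafSigma M R₀ τ) : |f p.1 p.2| ≤ c := by
  obtain ⟨h1, h2⟩ := le_of_mem_leafSigma hM hR₀ hτ hp
  rcases h1.lt_or_eq with h3 | h3
  · exact h p hp h3
  have hp' : p.1 - p.2 = τ := by
    rcases hp with hp | hp
    · exact hp.1
    · linarith [hp.1]
  have hc := hf p ⟨h1, sub_nonneg.2 h2, τ, hτ𝒯, hp⟩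
  have hcurve : Tendsto (fun r : ℝ => (τ + r, r)) (𝓝[>] M) (𝓝 p) := by
    have : Tendsto (fun r : ℝ => (τ + r, r)) (𝓝 M) (𝓝 (τ + M, M)) :=
      (by fun_prop : Continuous (fun r : ℝ => (τ + r, r))).tendsto M
    rw [show p = (τ + M, M) from Prod.ext (by simp; linarith) h3.symm]
    exact this.mono_left nhdsWithin_le_nhds
  refine le_of_tendsto (hc.tendsto.comp hcurve).abs ?_
  filter_upwards [Ioo_mem_nhdsGT hR₀] with r hr
  exact h (τ + r, r) (Or.inl ⟨by simp, hr.1.le, hr.2.le⟩) hr.1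

/-- The data density is controlled by the initial energy. -/
theorem integral_dataDensity_le {M R₀ E₀ ε : ℝ} (hM : 0 < M) (hR₀ : M < R₀) (hE₀ : 0 ≤ E₀)
    (hε : 0 < ε) {ψ : ℝ → ℝ → ℝ} (hψ : ∀ r, M ≤ r → SmoothAt ψ (r, r))
    (h : initialEnergy M R₀ (fun v r => ψ v r / ε) = ENNReal.ofReal E₀) :
    ∫ r in M..R₀, dataDensity M ψ r ≤ (2 / M * √E₀ * ε) ^ 2 := by
  have hY : ∀ f : ℝ → ℝ → ℝ, vfY (fun v r => f v r / ε) = fun v r => vfY f v r / ε := fun f => by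
    funext v r; exact deriv_div_const _
  have hT : ∀ f : ℝ → ℝ → ℝ, vfT (fun v r => f v r / ε) = fun v r => vfT f v r / ε := fun f => by
    funext v r; exact deriv_div_const _
  have hN : ∀ f : ℝ → ℝ → ℝ, normalDeriv M (fun v r => f v r / ε)
      = fun v r => normalDeriv M f v r / ε := fun f => by
    funext v r
    simp only [normalDeriv, hY, hT]
    ring
  have hX : ∀ f : ℝ → ℝ → ℝ, tangentDeriv M (fun v r => f v r / ε)
      = fun v r => tangentDeriv M f v r / ε := fun f => by
    funext v r
    simp only [tangentDeriv, hY, hT]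
    ring
  have hn : ∀ r, M ≤ r → SmoothAt (normalDeriv M ψ) (r, r) := fun r hr => (hψ r hr).normalDeriv hM hr
  have hcont : ∀ f : ℝ → ℝ → ℝ, (∀ r, M ≤ r → SmoothAt f (r, r)) →
      ContinuousOn (fun r => f r r / ε) (Icc M R₀) :=
    fun f hf r hr => ((hf r hr.1).continuousAt_diag.div_const ε).continuousWithinAt
  have cY := hcont _ fun r hr => (hψ r hr).vfY
  have cT := hcont _ fun r hr => (hψ r hr).vfT
  have cN := hcont _ fun r hr => (hn r hr).normalDeriv hM hr
  have cX := hcont _ fun r hr => (hn r hr).tangentDeriv hM hr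
  have c1 : ContinuousOn (fun r => (vfY ψ r r / ε) ^ 2 + (vfT ψ r r / ε) ^ 2) (Icc M R₀) :=
    (cY.pow 2).add (cT.pow 2)
  have c2 : ContinuousOn (fun r => ((normalDeriv M (normalDeriv M ψ) r r / ε) ^ 2
      + (tangentDeriv M (normalDeriv M ψ) r r / ε) ^ 2) / 2) (Icc M R₀) :=
    ((cN.pow 2).add (cX.pow 2)).div_const 2
  unfold initialEnergy at h
  unfold energyDensity at h
  simp only [hY, hT, hN, hX] at h
  have h1 := integral_le_of_intS_le hM hR₀.le hE₀ (fun v r => by positivity) c1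
    ((le_self_add.trans le_self_add).trans h.le)
  have h2 := integral_le_of_intS_le hM hR₀.le hE₀ (fun v r => by positivity) c2
    ((le_self_add.trans le_add_self).trans h.le)
  have e : ∀ r, dataDensity M ψ r = ε ^ 2 * ((vfY ψ r r / ε) ^ 2 + (vfT ψ r r / ε) ^ 2)
      + 2 * ε ^ 2 * (((normalDeriv M (normalDeriv M ψ) r r / ε) ^ 2
      + (tangentDeriv M (normalDeriv M ψ) r r / ε) ^ 2) / 2) := fun r => by
    unfold dataDensity
    field_simp
    ring
  simp_rw [e]
  rw [intervalIntegral.integral_add, intervalIntegral.integral_const_mul,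
    intervalIntegral.integral_const_mul]
  -- The two parts contribute `1 + 2 = 3` multiples of `ε² E₀/M²`, rounded up to the square `4`.
  · have e2 : (2 / M * √E₀ * ε) ^ 2 = ε ^ 2 * (4 * (E₀ / M ^ 2)) := by
      rw [mul_pow, mul_pow, Real.sq_sqrt hE₀]
      field_simp
      ring
    have : 0 ≤ E₀ / M ^ 2 := by positivity
    have := sq_pos_of_pos hε
    rw [e2]
    nlinarith
  · exact (continuousOn_const.mul c1).intervalIntegrable_of_Icc hR₀.le
  · exact (continuousOn_const.mul c2).intervalIntegrable_of_Icc hR₀.le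

end ExtremalRN

/-- The change of unknown `linearizer A` turns the equation into the linear wave equation, whose
spherically symmetric solutions are bounded by the data on `{v = r}` alone: the conserved energy of
the time integral of the solution, expressed through the dual potential, bounds `r φ`, and transport
along null rays then bounds `Y (r φ)` and `r² ∂_v (r φ)`. Hence the bootstrap assumptions are not
used, and the bounds hold with `r ^ β` replaced by a constant. -/
theorem mainTheorem4 (M R₀ : ℝ) (hM : 0 < M) (hR₀ : 2 * M < R₀) (a : ℕ → ℝ)
    (α Cα : ℝ) (hα : 0 < α) (hCα : 0 < Cα) :
    ∃ C : ℝ, 0 < C ∧ ∃ Cbar : ℝ → ℝ, (∀ β, 0 < β → 0 < Cbar β) ∧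
      (Cbar =O[𝓝[>] (0 : ℝ)] fun β => 1 / β) ∧
      ∀ E₀ : ℝ, 0 ≤ E₀ → ∃ εr : ℝ, 0 < εr ∧ ∀ ε : ℝ, 0 < ε → ε < εr →
        ∀ A : ℝ → ℝ, BoundedGeometry a A →
        ∀ (𝒯 : EReal) (ψ : ℝ → ℝ → ℝ), 0 < 𝒯 → IsSolution M R₀ A 𝒯 ψ →
          initialEnergy M R₀ (fun v r => ψ v r / ε) = ENNReal.ofReal E₀ →
          Bootstrap M R₀ A α Cα E₀ ε 𝒯 ψ →
          ∀ τ : ℝ, 0 ≤ τ → (τ : EReal) < 𝒯 → ∀ v r : ℝ, (v, r) ∈ leafSigma M R₀ τ →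
            |vfY ψ v r| ≤ C * √E₀ * ε ∧
            ∀ β : ℝ, 0 < β →
              |r * ψ v r| ≤ Cbar β * √E₀ * ε * r ^ β ∧
              |r ^ 2 * nullDv M ψ v r| ≤ Cbar β * √E₀ * ε * r ^ β := by
  have hMR : M < R₀ := by linarith
  obtain ⟨B, κ, hB, hκ, hmain⟩ := exists_nonlinear_bound hM hR₀ (abs_nonneg (a 0))
  set C := B * (2 / M) with hC
  have hC0 : 0 < C := by positivity
  -- The factor `M ^ (-β)` compensates `r ^ β ≥ M ^ β`; it stays bounded as `β → 0⁺`, hence is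
  -- `O(1/β)`.
  refine ⟨C, hC0, fun β => C * M ^ (-β), fun β _ => by positivity, ?_, ?_⟩
  · have h1 : (fun β : ℝ => C * M ^ (-β)) =O[𝓝[>] (0 : ℝ)] fun _ => (1 : ℝ) := by
      have hc : Continuous fun β : ℝ => C * M ^ (-β) :=
        continuous_const.mul (Real.continuous_const_rpow hM.ne' |>.comp continuous_neg)
      exact ((hc.tendsto 0).mono_left nhdsWithin_le_nhds).isBigO_one ℝ
    refine h1.trans (IsBigO.of_bound 1 ?_)
    filter_upwards [Ioo_mem_nhdsGT (zero_lt_one (α := ℝ))] with β hβ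
    rw [one_mul, norm_one, Real.norm_eq_abs, abs_of_pos (one_div_pos.2 hβ.1)]
    exact one_le_one_div hβ.1 hβ.2.le
  intro E₀ hE₀
  have hs0 : 0 ≤ 2 / M * √E₀ := by positivity
  refine ⟨κ / (2 / M * √E₀ + 1), by positivity, ?_⟩
  intro ε hε hεr A hA 𝒯 ψ h𝒯 hψ hE _ τ hτ hτ𝒯 v r hvr
  rw [lt_div_iff₀ (by positivity)] at hεr
  have hAb : ∀ x, |A x| ≤ |a 0| := fun x => by
    have := hA.bound 0 x
    rw [iteratedDeriv_zero] at this
    exact this.trans (le_abs_self _)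
  have hψs : ∀ r, M ≤ r → SmoothAt ψ (r, r) := fun r hr =>
    hψ.smooth _ (initial_mem_region hM hMR h𝒯 hr)
  have hint := integral_dataDensity_le hM hMR hE₀ hε hψs hE
  set s := 2 / M * √E₀ * ε with hs
  have hs1 : 0 ≤ s := by positivity
  have hsκ : s < κ := by rw [hs]; nlinarith
  have hCs : C * √E₀ * ε = B * s := by rw [hC, hs]; ring
  -- `E₀ = 0` allows `s = 0`, while the nonlinear bound needs `k > 0`; it is applied for `k > s` and
  -- `k` tends to `s`.
  have hlim : ∀ x, (∀ k ∈ Ioo s κ, x ≤ B * k) → x ≤ B * s := fun x hx => by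
    have ht : Tendsto (fun k => B * k) (𝓝[>] s) (𝓝 (B * s)) :=
      ((by fun_prop : Continuous (fun k => B * k)).tendsto s).mono_left nhdsWithin_le_nhds
    refine ge_of_tendsto ht ?_
    filter_upwards [Ioo_mem_nhdsGT hsκ] with k hk using hx k hk
  have hb := fun k (hk : k ∈ Ioo s κ) => hmain k A 𝒯 ψ (hs1.trans_lt hk.1) hk.2 hA.smooth hAb h𝒯 hψ
    (hint.trans (by have := hk.1.le; gcongr)) τ hτ hτ𝒯
  have hcY : ∀ p ∈ region M R₀ 𝒯, SmoothAt (vfY ψ) p := fun p hp => SmoothAt.vfY (hψ.smooth p hp)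
  have hcT : ∀ p ∈ region M R₀ 𝒯, SmoothAt (vfT ψ) p := fun p hp => SmoothAt.vfT (hψ.smooth p hp)
  have hr := (le_of_mem_leafSigma hM hMR hτ hvr).1
  simp only at hr
  have b1 : |vfY ψ v r| ≤ B * s := hlim _ fun k hk =>
    le_on_leafSigma_of_lt hM hMR hτ hτ𝒯 (f := vfY ψ) (fun p hp => (hcY p hp).continuousAt)
      (fun p hp hpM => (hb k hk p hp hpM).1) hvr
  have b2 : |r * ψ v r| ≤ B * s := hlim _ fun k hk =>
    le_on_leafSigma_of_lt hM hMR hτ hτ𝒯 (f := fun v r => r * ψ v r)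
      (fun p hp => continuousAt_snd.mul (hψ.smooth p hp).continuousAt)
      (fun p hp hpM => (hb k hk p hp hpM).2.1) hvr
  have b3 : |r ^ 2 * nullDv M ψ v r| ≤ B * s := hlim _ fun k hk =>
    le_on_leafSigma_of_lt hM hMR hτ hτ𝒯 (f := fun v r => r ^ 2 * nullDv M ψ v r)
      (fun p hp => (continuousAt_snd.pow 2).mul ((hcT p hp).continuousAt.add
        (((contDiffAt_metricD_snd hM hp.1).continuousAt.div_const 2).mul
          (hcY p hp).continuousAt)))
      (fun p hp hpM => (hb k hk p hp hpM).2.2) hvr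
  refine ⟨hCs ▸ b1, fun β hβ => ?_⟩
  have hβ1 : B * s ≤ C * M ^ (-β) * √E₀ * ε * r ^ β := by
    have h1 : 1 ≤ M ^ (-β) * r ^ β := by
      rw [Real.rpow_neg hM.le, ← div_eq_inv_mul, one_le_div (Real.rpow_pos_of_pos hM β)]
      exact Real.rpow_le_rpow hM.le hr hβ.le
    calc B * s ≤ B * s * (M ^ (-β) * r ^ β) := le_mul_of_one_le_right (by positivity) h1
      _ = _ := by rw [← hCs]; ring
  exact ⟨b2.trans hβ1, b3.trans hβ1⟩
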